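/- Let $k$ be a field of characteristic zero, let $G$ be a finite simple graph with vertices $v_1,\dots,v_n$, and let $R=k[x_1,\dots,x_n]$. Let $F_G=\prod_{i<j,\ \{v_i,v_j\}\in E(G)}(x_i-x_j)$ be the polynomial defining the graphic arrangement $\mathcal A_G$, and let $J_G=\langle \partial F_G/\partial x_1,\dots,\partial F_G/\partial x_n\rangle$ be its Jacobian ideal. Let $\overline{J}_G$ be the top-dimensional part of $J_G$, i.e. the intersection of the primary ideals whose associated prime has height two in a minimal primary decomposition of $J_G$ (with $\overline J_G=R$ if there are none). Assume that no two distinct 3-cycles of $G$ share an edge. Then the rings $R/\sqrt{J_G}$ and $R/\overline{J}_G$ are both Cohen–Macaulay (where the zero ring is counted as Cohen–Macaulay). -/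

import Mathlib

noncomputable section

namespace GraphicCM

/-- The depth of a local ring: the supremum of the lengths of the regular sequences contained in
its maximal ideal. -/
def localDepth (A : Type*) [CommRing A] [IsLocalRing A] : ℕ∞ :=
  ⨆ rs : {rs : List A // (∀ r ∈ rs, r ∈ IsLocalRing.maximalIdeal A) ∧
    RingTheory.Sequence.IsRegular A rs}, (rs.1.length : ℕ∞)

/-- A commutative ring is Cohen–Macaulay if it is Noetherian and its localization at every prime
ideal has depth equal to its Krull dimension. (The zero ring satisfies this, by convention.) -/
structure IsCohenMacaulay (A : Type*) [CommRing A] : Prop where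
  noetherian : IsNoetherianRing A
  depth_eq_dim : ∀ (p : Ideal A) [p.IsPrime],
    ((localDepth (Localization.AtPrime p) : ℕ∞) : WithBot ℕ∞) =
      ringKrullDim (Localization.AtPrime p)

open Classical in
/-- The product of the linear forms `x_i - x_j`, one for every edge `{i, j}` of `G` (with `i < j`),
which defines the graphic arrangement of `G`. -/
def graphicPolynomial (k : Type*) [Field k] {n : ℕ} (G : SimpleGraph (Fin n)) :
    MvPolynomial (Fin n) k :=
  ∏ e : Fin n × Fin n with e.1 < e.2 ∧ G.Adj e.1 e.2, (MvPolynomial.X e.1 - MvPolynomial.X e.2)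

/-- The Jacobian ideal of a polynomial: the ideal generated by its first partial derivatives. -/
def jacobianIdeal {k : Type*} [Field k] {n : ℕ} (F : MvPolynomial (Fin n) k) :
    Ideal (MvPolynomial (Fin n) k) :=
  Ideal.span (Set.range fun i => MvPolynomial.pderiv i F)

/-- `K` is a top-dimensional part of `J`: the intersection of those primary ideals in
a (minimal) primary decomposition of `J` whose associated prime has height two. -/
def IsHeightTwoPart {A : Type*} [CommRing A] (J K : Ideal A) : Prop :=
  ∃ t : Finset (Ideal A), Submodule.IsMinimalPrimaryDecomposition J t ∧
    K = ⨅ q ∈ {q : Ideal A | q ∈ t ∧ q.radical.height = 2}, q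

/-- Over a Noetherian ring such an ideal exists. -/
theorem exists_isHeightTwoPart {A : Type*} [CommRing A] [IsNoetherianRing A] (J : Ideal A) :
    ∃ K : Ideal A, IsHeightTwoPart J K := by
  obtain ⟨t, ht⟩ := Submodule.IsLasker.exists_isMinimalPrimaryDecomposition (Submodule.isLasker A A) J
  exact ⟨_, t, ht, rfl⟩

end GraphicCM

end

/-!
The hyperplanes are grouped into blocks: the triangles of `G`, and the edges on no triangle. With
`f_t` the product of the forms in the block `t`, both `√J` and `J̄` have the shape
`∑_t (∏_{s ≠ t} f_s) I_t`, where `I_t` is the radical of the Jacobian ideal of `f_t` or that ideal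
itself: such a sum is contained in all minimal primes of `J`, and these are the linear primes `P` of
the codimension-two flats, at each of which it is easily compared with `J`. Adding one block at a
time, a liaison argument filters the quotient by such a sum with factors `R ⧸ P`. Over an infinite
field one linear subspace is complementary to all these flats, so every `R ⧸ P`, and hence the
quotient, is finite and projective over one and the same polynomial ring; therefore it is
Cohen–Macaulay.
-/

namespace GraphicCM

section CohenMacaulay

open RingTheory.Sequence IsLocalRing
open scoped Pointwise

theorem spanFinrank_maximalIdeal_quotient_lt {A : Type*} [CommRing A] [IsLocalRing A]
    [IsNoetherianRing A] {x : A} [IsLocalRing (A ⧸ Ideal.span {x})] (hx : x ∈ maximalIdeal A)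
    (hx2 : x ∉ maximalIdeal A ^ 2) :
    (maximalIdeal (A ⧸ Ideal.span {x})).spanFinrank < (maximalIdeal A).spanFinrank := by
  classical
  obtain ⟨s, hcard, hs⟩ := Submodule.FG.exists_span_finset_card_eq_spanFinrank
    (maximalIdeal A).fg_of_isNoetherianRing
  obtain ⟨c, -, hc⟩ := Submodule.mem_span_finset.mp (hs.symm ▸ hx)
  obtain ⟨a, has, ha⟩ : ∃ a ∈ s, IsUnit (c a) := by
    by_contra! hunit
    refine hx2 (hc ▸ sum_mem fun a has => ?_)
    rw [pow_two]
    exact Ideal.mul_mem_mul ((mem_maximalIdeal _).mpr (hunit a has))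
      (hs ▸ Submodule.subset_span has)
  let π := Ideal.Quotient.mk (Ideal.span {x})
  have hπa : π a ∈ Ideal.span (π '' (s.erase a : Finset A)) := by
    have hsum : π (c a) * π a + ∑ b ∈ s.erase a, π (c b) * π b = 0 := by
      have hπx : π x = 0 := Ideal.Quotient.eq_zero_iff_mem.mpr (Ideal.mem_span_singleton_self x)
      calc π (c a) * π a + ∑ b ∈ s.erase a, π (c b) * π b = π (∑ b ∈ s, c b • b) := by
            simp only [← Finset.add_sum_erase s _ has, smul_eq_mul, map_add, map_sum, map_mul]
        _ = 0 := by rw [hc, hπx]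
    rw [← Ideal.unit_mul_mem_iff_mem _ (ha.map π), eq_neg_of_add_eq_zero_left hsum]
    exact neg_mem (sum_mem fun b hb =>
      Ideal.mul_mem_left _ _ (Ideal.subset_span (Set.mem_image_of_mem π hb)))
  have hspan : maximalIdeal (A ⧸ Ideal.span {x}) = Ideal.span (π '' (s.erase a : Finset A)) := by
    rw [← map_maximalIdeal_of_surjective π Ideal.Quotient.mk_surjective, ← hs,
      Ideal.submodule_span_eq, Ideal.map_span]
    conv_lhs => rw [← Finset.insert_erase has, Finset.coe_insert, Set.image_insert_eq]
    exact Submodule.span_insert_eq_span hπa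
  calc (maximalIdeal (A ⧸ Ideal.span {x})).spanFinrank
      ≤ (π '' (s.erase a : Finset A)).ncard :=
        hspan ▸ Submodule.spanFinrank_span_le_ncard_of_finite (Set.toFinite _)
    _ ≤ (s.erase a).card := by
        simpa only [Set.ncard_coe_finset] using Set.ncard_image_le (Finset.finite_toSet (s.erase a))
    _ < (maximalIdeal A).spanFinrank := hcard ▸ Finset.card_erase_lt_of_mem has

theorem exists_mem_maximalIdeal_notMem_minimalPrimes {A : Type*} [CommRing A] [IsLocalRing A]
    [IsNoetherianRing A] (h : maximalIdeal A ∉ minimalPrimes A) :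
    ∃ x ∈ maximalIdeal A, x ∉ maximalIdeal A ^ 2 ∧ ∀ P ∈ minimalPrimes A, x ∉ P := by
  by_contra! hcover
  have hfin := (minimalPrimes.finite_of_isNoetherianRing A).insert (maximalIdeal A ^ 2)
  obtain ⟨P, hP, hle⟩ := (Ideal.subset_union_prime_finite hfin (f := id) (maximalIdeal A ^ 2)
    (maximalIdeal A ^ 2) (fun P hP hne _ => (hP.resolve_left hne).1.1) (I := maximalIdeal A)).mp
    fun x hx => by
      by_cases hx2 : x ∈ maximalIdeal A ^ 2
      · exact Set.mem_biUnion (Set.mem_insert _ _) hx2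
      · obtain ⟨P, hP, hxP⟩ := hcover x hx hx2
        exact Set.mem_biUnion (Set.mem_insert_of_mem _ hP) hxP
  rcases hP with rfl | hP
  · have hbot : maximalIdeal A = ⊥ := Submodule.eq_bot_of_le_smul_of_le_jacobson_bot _ _
      (maximalIdeal A).fg_of_isNoetherianRing (by rwa [smul_eq_mul, ← pow_two])
      (maximalIdeal_le_jacobson _)
    exact h ⟨⟨inferInstance, bot_le⟩, fun P _ _ => hbot.trans_le bot_le⟩
  · exact h (by rwa [← (maximalIdeal.isMaximal A).eq_of_le hP.1.1.ne_top hle] at hP)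

theorem ringKrullDim_le_ringKrullDim_quotient_span_singleton_add_one {A : Type*} [CommRing A]
    [IsLocalRing A] [IsNoetherianRing A] {x : A} (hx : x ∈ maximalIdeal A) :
    ringKrullDim A ≤ ringKrullDim (A ⧸ Ideal.span {x}) + 1 := by
  have h := ringKrullDim_le_ringKrullDim_quotient_add_card {x} (by
    simpa [ringJacobson_eq_maximalIdeal] using hx)
  rwa [Finset.coe_singleton, Finset.card_singleton, Nat.cast_one] at h

theorem isRegularLocalRing_quotient_span_singleton {A : Type*} [CommRing A] [IsRegularLocalRing A]
    {x : A} (hx : x ∈ maximalIdeal A) (hx2 : x ∉ maximalIdeal A ^ 2) :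
    IsRegularLocalRing (A ⧸ Ideal.span {x}) := by
  have : Nontrivial (A ⧸ Ideal.span {x}) := Ideal.Quotient.nontrivial_iff.mpr <|
    ne_top_of_le_ne_top Ideal.IsPrime.ne_top' ((Ideal.span_singleton_le_iff_mem _).mpr hx)
  have : IsLocalRing (A ⧸ Ideal.span {x}) :=
    IsLocalRing.of_surjective' _ Ideal.Quotient.mk_surjective
  refine .of_spanFinrank_maximalIdeal_le _ ?_
  have hlt := spanFinrank_maximalIdeal_quotient_lt hx hx2
  have hdim := ringKrullDim_le_ringKrullDim_quotient_span_singleton_add_one hx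
  rw [← (isRegularLocalRing_iff A).mp ‹_›,
    ← maximalIdeal_height_eq_ringKrullDim (R := A ⧸ Ideal.span {x})] at hdim
  rw [← maximalIdeal_height_eq_ringKrullDim (R := A ⧸ Ideal.span {x})]
  generalize (maximalIdeal (A ⧸ Ideal.span {x})).height = h at *
  have hdim' : ((maximalIdeal A).spanFinrank : ℕ∞) ≤ h + 1 := by exact_mod_cast hdim
  have hlt' : ((maximalIdeal (A ⧸ Ideal.span {x})).spanFinrank : ℕ∞) + 1 ≤
      (maximalIdeal A).spanFinrank := by exact_mod_cast hlt
  exact_mod_cast (ENat.add_le_add_iff_right ENat.one_ne_top).mp (hlt'.trans hdim')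

theorem maximalIdeal_notMem_minimalPrimes {A : Type*} [CommRing A] [IsRegularLocalRing A]
    (h : (maximalIdeal A).spanFinrank ≠ 0) : maximalIdeal A ∉ minimalPrimes A := fun hmin => by
  have hdim := (isRegularLocalRing_iff A).mp ‹_›
  rw [← maximalIdeal_height_eq_ringKrullDim, Ideal.height_eq_zero_iff.mpr hmin] at hdim
  exact h (by exact_mod_cast hdim)

theorem isDomain_of_isRegularLocalRing {A : Type*} [CommRing A] [IsRegularLocalRing A] :
    IsDomain A := by
  induction hn : (maximalIdeal A).spanFinrank using Nat.strong_induction_on generalizing A with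
  | _ n ih =>
  subst hn
  rcases eq_or_ne (maximalIdeal A).spanFinrank 0 with h0 | h0
  · exact (isField_iff_maximalIdeal_eq.mpr ((Submodule.spanFinrank_eq_zero_iff_eq_bot
      (maximalIdeal A).fg_of_isNoetherianRing).mp h0)).isDomain
  · obtain ⟨x, hx, hx2, hxmin⟩ :=
      exists_mem_maximalIdeal_notMem_minimalPrimes (maximalIdeal_notMem_minimalPrimes h0)
    have := isRegularLocalRing_quotient_span_singleton hx hx2
    have hprime : (Ideal.span {x}).IsPrime := (Ideal.Quotient.isDomain_iff_prime _).mp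
      (ih _ (spanFinrank_maximalIdeal_quotient_lt hx hx2) rfl)
    obtain ⟨P, hP, hPx⟩ := Ideal.exists_minimalPrimes_le (bot_le (a := Ideal.span {x}))
    have hPprime : P.IsPrime := hP.1.1
    have hPbot : P = ⊥ := by
      refine Submodule.eq_bot_of_le_smul_of_le_jacobson_bot (maximalIdeal A) P
        P.fg_of_isNoetherianRing (fun y hy => ?_) (maximalIdeal_le_jacobson _)
      obtain ⟨z, rfl⟩ := Ideal.mem_span_singleton.mp (hPx hy)
      exact Ideal.mul_mem_mul hx ((hPprime.mem_or_mem hy).resolve_left (hxmin P hP))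
    have : (⊥ : Ideal A).IsPrime := hPbot ▸ hPprime
    exact IsDomain.of_bot_isPrime A

/-- The ring has a regular sequence at least as long as its Krull dimension. For Noetherian local
rings this is the Cohen–Macaulay property in a form that passes to finite flat extensions. -/
def HasFullRegularSequence (A : Type*) [CommRing A] : Prop :=
  ∃ rs : List A, IsRegular A rs ∧ ringKrullDim A ≤ rs.length

theorem HasFullRegularSequence.of_quotient_span_singleton {A : Type*} [CommRing A] [IsLocalRing A]
    [IsNoetherianRing A] {x : A} (hx : x ∈ maximalIdeal A) (hreg : IsSMulRegular A x)
    (h : HasFullRegularSequence (A ⧸ Ideal.span {x})) : HasFullRegularSequence A := by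
  obtain ⟨rs, hrs, hdim⟩ := h
  obtain ⟨ts, rfl⟩ : ∃ ts : List A, ts.map (Ideal.Quotient.mk (Ideal.span {x})) = rs :=
    (List.map_surjective_iff.mpr Ideal.Quotient.mk_surjective) rs
  have htop : Ideal.span {x} = x • (⊤ : Submodule A A) := by
    simp [← Submodule.ideal_span_singleton_smul]
  refine ⟨x :: ts, (isRegular_cons_iff' A x ts).mpr ⟨hreg, ?_⟩, ?_⟩
  · refine (AddEquiv.isRegular_congr (e := (Submodule.quotEquivOfEq _ _ htop).toAddEquiv) <|
      List.forall₂_same.mpr fun r _ y => ?_).mp hrs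
    obtain ⟨r, rfl⟩ := Ideal.Quotient.mk_surjective r
    exact map_smul (Submodule.quotEquivOfEq _ _ htop) r y
  · calc ringKrullDim A ≤ ringKrullDim (A ⧸ Ideal.span {x}) + 1 :=
          ringKrullDim_le_ringKrullDim_quotient_span_singleton_add_one hx
      _ ≤ (x :: ts).length := by simpa using add_le_add_left hdim 1

theorem hasFullRegularSequence_of_isRegularLocalRing {A : Type*} [CommRing A]
    [IsRegularLocalRing A] : HasFullRegularSequence A := by
  induction hn : (maximalIdeal A).spanFinrank using Nat.strong_induction_on generalizing A with
  | _ n ih =>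
  subst hn
  rcases eq_or_ne (maximalIdeal A).spanFinrank 0 with h0 | h0
  · exact ⟨[], IsRegular.nil _ _, by simp [← (isRegularLocalRing_iff A).mp ‹_›, h0]⟩
  · obtain ⟨x, hx, hx2, -⟩ :=
      exists_mem_maximalIdeal_notMem_minimalPrimes (maximalIdeal_notMem_minimalPrimes h0)
    have := isRegularLocalRing_quotient_span_singleton hx hx2
    have := isDomain_of_isRegularLocalRing (A := A)
    have hx0 : x ≠ 0 := fun h => hx2 (h ▸ zero_mem _)
    exact .of_quotient_span_singleton hx (IsSMulRegular.of_ne_zero hx0)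
      (ih _ (spanFinrank_maximalIdeal_quotient_lt hx hx2) rfl)

theorem mem_maximalIdeal_of_isRegular {A : Type*} [CommRing A] [IsLocalRing A] {rs : List A}
    (h : IsRegular A rs) : ∀ r ∈ rs, r ∈ maximalIdeal A := fun r hr => by
  by_contra hunit
  have htop : Ideal.ofList rs = ⊤ :=
    Ideal.eq_top_of_isUnit_mem _ (Ideal.subset_span hr) (notMem_maximalIdeal.mp hunit)
  exact h.2 (by simp [htop])

theorem length_le_ringKrullDim_of_isRegular {A : Type*} [CommRing A] [IsLocalRing A]
    [IsNoetherianRing A] {rs : List A} (h : IsRegular A rs) : rs.length ≤ ringKrullDim A := by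
  have : Nontrivial (A ⧸ Ideal.ofList rs) :=
    Ideal.Quotient.nontrivial_iff.mpr fun htop => h.2 (by simp [htop])
  rw [← ringKrullDim_add_length_eq_ringKrullDim_of_isRegular rs h]
  exact le_add_of_nonneg_left ringKrullDim_nonneg_of_nontrivial

theorem length_le_localDepth {A : Type*} [CommRing A] [IsLocalRing A] {rs : List A}
    (h : IsRegular A rs) : rs.length ≤ localDepth A :=
  le_iSup (fun rs : {rs : List A // (∀ r ∈ rs, r ∈ maximalIdeal A) ∧ IsRegular A rs} =>
    (rs.1.length : ℕ∞)) ⟨rs, mem_maximalIdeal_of_isRegular h, h⟩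

theorem localDepth_le_ringKrullDim (A : Type*) [CommRing A] [IsLocalRing A] [IsNoetherianRing A] :
    (localDepth A : WithBot ℕ∞) ≤ ringKrullDim A := by
  rw [← maximalIdeal_height_eq_ringKrullDim, WithBot.coe_le_coe]
  refine iSup_le fun ⟨rs, _, hrs⟩ => WithBot.coe_le_coe.mp ?_
  exact (length_le_ringKrullDim_of_isRegular hrs).trans_eq
    maximalIdeal_height_eq_ringKrullDim.symm

theorem exists_isRegular_length_eq_localDepth (A : Type*) [CommRing A] [IsLocalRing A]
    [IsNoetherianRing A] : ∃ rs : List A, IsRegular A rs ∧ (rs.length : ℕ∞) = localDepth A := by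
  have : Nonempty {rs : List A // (∀ r ∈ rs, r ∈ maximalIdeal A) ∧ IsRegular A rs} :=
    ⟨[], by simp, IsRegular.nil _ _⟩
  have hlt : localDepth A < ⊤ := WithBot.coe_lt_coe.mp <|
    (localDepth_le_ringKrullDim A).trans_lt ringKrullDim_lt_top
  obtain ⟨⟨rs, _, hrs⟩, h⟩ := ENat.exists_eq_iSup_of_lt_top hlt
  exact ⟨rs, hrs, h⟩

theorem localDepth_eq_ringKrullDim_iff {A : Type*} [CommRing A] [IsLocalRing A]
    [IsNoetherianRing A] :
    (localDepth A : WithBot ℕ∞) = ringKrullDim A ↔ HasFullRegularSequence A := by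
  constructor
  · intro h
    obtain ⟨rs, hrs, hlen⟩ := exists_isRegular_length_eq_localDepth A
    exact ⟨rs, hrs, by rw [← h, ← hlen]; rfl⟩
  · rintro ⟨rs, hrs, hdim⟩
    exact (localDepth_le_ringKrullDim A).antisymm <|
      hdim.trans (WithBot.coe_le_coe.mpr (length_le_localDepth hrs))

theorem isCohenMacaulay_iff {A : Type*} [CommRing A] [IsNoetherianRing A] :
    IsCohenMacaulay A ↔
      ∀ (p : Ideal A) [p.IsPrime], HasFullRegularSequence (Localization.AtPrime p) := by
  have (p : Ideal A) [p.IsPrime] : IsNoetherianRing (Localization.AtPrime p) :=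
    IsLocalization.isNoetherianRing p.primeCompl _ ‹_›
  exact ⟨fun h p _ => localDepth_eq_ringKrullDim_iff.mp (h.depth_eq_dim p),
    fun h => ⟨‹_›, fun p _ => localDepth_eq_ringKrullDim_iff.mpr (h p)⟩⟩

theorem isCohenMacaulay_of_isRegularRing (A : Type*) [CommRing A] [IsRegularRing A] :
    IsCohenMacaulay A :=
  isCohenMacaulay_iff.mpr fun _ _ => hasFullRegularSequence_of_isRegularLocalRing

theorem height_le_height_under_of_isIntegral {A B : Type*} [CommRing A] [CommRing B] [Algebra A B]
    [Algebra.IsIntegral A B] (p : Ideal B) [hp : p.IsPrime] :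
    p.height ≤ (p.under A).height := by
  have hmono : StrictMono (PrimeSpectrum.comap (algebraMap A B)) := fun I J hIJ =>
    Ideal.IsIntegral.comap_lt_comap (I := I.asIdeal) (J := J.asIdeal) hIJ
  have h := Order.height_le_height_apply_of_strictMono _ hmono ⟨p, hp⟩
  rwa [← PrimeSpectrum.height_eq_orderHeight, ← PrimeSpectrum.height_eq_orderHeight] at h

theorem IsCohenMacaulay.of_finite_flat {A B : Type*} [CommRing A] [CommRing B] [Algebra A B]
    [Module.Finite A B] [Module.Flat A B] (h : IsCohenMacaulay A) : IsCohenMacaulay B := by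
  have := h.noetherian
  have : IsNoetherianRing B := .of_finite A B
  refine isCohenMacaulay_iff.mpr fun p hp => ?_
  obtain ⟨rs, hrs, hdim⟩ := isCohenMacaulay_iff.mp h (p.under A)
  let φ := Localization.localRingHom (p.under A) p (algebraMap A B) rfl
  have hflat : φ.Flat :=
    (RingHom.flat_algebraMap_iff.mpr ‹_› : (algebraMap A B).Flat).localRingHom p (p.under A) rfl
  have hlocal : IsLocalHom φ := Localization.isLocalHom_localRingHom _ _ _ _
  let := φ.toAlgebra
  have : Module.Flat (Localization.AtPrime (p.under A)) (Localization.AtPrime p) := hflat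
  have : IsLocalHom (algebraMap (Localization.AtPrime (p.under A)) (Localization.AtPrime p)) :=
    hlocal
  have := Module.FaithfullyFlat.of_flat_of_isLocalHom
    (A := Localization.AtPrime (p.under A)) (B := Localization.AtPrime p)
  refine ⟨_, hrs.of_faithfullyFlat (S := Localization.AtPrime p), ?_⟩
  rw [IsLocalization.AtPrime.ringKrullDim_eq_height (p.under A)] at hdim
  rw [IsLocalization.AtPrime.ringKrullDim_eq_height p, List.length_map]
  exact (WithBot.coe_le_coe.mpr (height_le_height_under_of_isIntegral p)).trans hdim

end CohenMacaulay

section Filtration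

variable {R : Type*} [CommRing R]

/-- The quotient of `R` by the ideal has a finite filtration whose factors are quotients `R ⧸ P`
with `P ∈ Ps`. A step of the filtration is encoded by the exact sequence
`0 → R ⧸ (I : g) → R ⧸ I → R ⧸ (I + (g)) → 0`. -/
inductive IsFilteredBy (Ps : Set (Ideal R)) : Ideal R → Prop
  | top : IsFilteredBy Ps ⊤
  | of_mem {P : Ideal R} : P ∈ Ps → IsFilteredBy Ps P
  | of_colon {I : Ideal R} (g : R) : IsFilteredBy Ps (I.colon {g}) →
      IsFilteredBy Ps (I ⊔ Ideal.span {g}) → IsFilteredBy Ps I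

variable {Ps : Set (Ideal R)} {I : Ideal R}

theorem IsFilteredBy.mem_of_forall_exists_mul_mem (hPs : ∀ P ∈ Ps, P.IsPrime)
    (h : IsFilteredBy Ps I) {x : R} (hx : ∀ P ∈ Ps, ∃ s ∉ P, s * x ∈ I) : x ∈ I := by
  induction h generalizing x with
  | top => exact Submodule.mem_top
  | @of_mem Q hQ =>
    obtain ⟨s, hs, hsx⟩ := hx Q hQ
    exact ((hPs Q hQ).mem_or_mem hsx).resolve_left hs
  | @of_colon I g _ _ ih_colon ih_sup =>
    have hsup : x ∈ I ⊔ Ideal.span {g} := ih_sup fun P hP =>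
      (hx P hP).imp fun s hs => ⟨hs.1, Ideal.mem_sup_left hs.2⟩
    obtain ⟨y, hy, z, hz, rfl⟩ := Submodule.mem_sup.mp hsup
    obtain ⟨c, rfl⟩ := Ideal.mem_span_singleton'.mp hz
    refine I.add_mem hy (Submodule.mem_colon_singleton.mp (ih_colon fun P hP => ?_))
    obtain ⟨s, hs, hsx⟩ := hx P hP
    refine ⟨s, hs, Submodule.mem_colon_singleton.mpr ?_⟩
    rw [mul_add, I.add_mem_iff_right (I.mul_mem_left s hy)] at hsx
    rwa [smul_eq_mul, mul_assoc]

theorem finite_projective_of_exact {A M N P : Type*} [CommRing A] [AddCommGroup M] [Module A M]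
    [AddCommGroup N] [Module A N] [AddCommGroup P] [Module A P] {f : M →ₗ[A] N} {g : N →ₗ[A] P}
    (hfg : Function.Exact f g) (hf : Function.Injective f) (hg : Function.Surjective g)
    (hM : Module.Finite A M ∧ Module.Projective A M)
    (hP : Module.Finite A P ∧ Module.Projective A P) :
    Module.Finite A N ∧ Module.Projective A N := by
  obtain ⟨_, _⟩ := hM
  obtain ⟨_, _⟩ := hP
  obtain ⟨s, hs⟩ := Module.projective_lifting_property g LinearMap.id hg
  let e := (hfg.splitSurjectiveEquiv hf ⟨s, hs⟩).1
  exact ⟨Module.Finite.equiv e.symm, Module.Projective.of_equiv e.symm⟩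

/-- Multiplication by `g` as a map `R ⧸ (I : g) → R ⧸ I`. -/
def colonMul (I : Ideal R) (g : R) : (R ⧸ I.colon {g}) →ₗ[R] (R ⧸ I) :=
  Submodule.mapQ _ _ (LinearMap.mulRight R g) fun _ hx => Submodule.mem_colon_singleton.mp hx

theorem colonMul_injective (I : Ideal R) (g : R) : Function.Injective (colonMul I g) := by
  refine (injective_iff_map_eq_zero _).mpr fun x hx => ?_
  obtain ⟨x, rfl⟩ := Ideal.Quotient.mk_surjective x
  exact Ideal.Quotient.eq_zero_iff_mem.mpr <| Submodule.mem_colon_singleton.mpr <|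
    Ideal.Quotient.eq_zero_iff_mem.mp hx

theorem exact_colonMul_factor (I : Ideal R) (g : R) :
    Function.Exact (colonMul I g)
      (Ideal.Quotient.factor (le_sup_left : I ≤ I ⊔ Ideal.span {g})) := fun x => by
  obtain ⟨x, rfl⟩ := Ideal.Quotient.mk_surjective x
  rw [Ideal.Quotient.factor_mk, Ideal.Quotient.eq_zero_iff_mem]
  constructor
  · intro hx
    obtain ⟨y, hy, z, hz, rfl⟩ := Submodule.mem_sup.mp hx
    obtain ⟨c, rfl⟩ := Ideal.mem_span_singleton'.mp hz
    exact ⟨Ideal.Quotient.mk _ c, (Ideal.Quotient.mk_eq_mk_iff_sub_mem _ _).mpr (by simpa)⟩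
  · rintro ⟨c, hc⟩
    obtain ⟨c, rfl⟩ := Ideal.Quotient.mk_surjective c
    have hx : x - c * g ∈ I := Ideal.Quotient.eq.mp hc.symm
    rw [← sub_add_cancel x (c * g)]
    exact add_mem (Ideal.mem_sup_left hx)
      (Ideal.mem_sup_right (Ideal.mul_mem_left _ _ (Ideal.mem_span_singleton_self g)))

theorem IsFilteredBy.finite_projective {A : Type*} [CommRing A] [Algebra A R]
    (hPs : ∀ P ∈ Ps, Module.Finite A (R ⧸ P) ∧ Module.Projective A (R ⧸ P))
    (h : IsFilteredBy Ps I) : Module.Finite A (R ⧸ I) ∧ Module.Projective A (R ⧸ I) := by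
  induction h with
  | top =>
    have : Subsingleton (R ⧸ (⊤ : Ideal R)) := Ideal.Quotient.subsingleton_iff.mpr rfl
    exact ⟨inferInstance, inferInstance⟩
  | of_mem hP => exact hPs _ hP
  | @of_colon I g _ _ ih_colon ih_sup =>
    exact finite_projective_of_exact (f := (colonMul I g).restrictScalars A)
      (g := (Ideal.Quotient.factorₐ A (le_sup_left : I ≤ I ⊔ Ideal.span {g})).toLinearMap)
      (exact_colonMul_factor I g) (colonMul_injective I g)
      (Ideal.Quotient.factor_surjective le_sup_left)
      ih_colon ih_sup

section RelPrime

variable [IsDomain R] [DecompositionMonoid R]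

theorem colon_span_singleton_mul_sup {I I' : Ideal R} {f f' : R} (hf0 : f ≠ 0) (hf' : f' ∈ I')
    (hrel : IsRelPrime f f') :
    (Ideal.span {f'} * I ⊔ Ideal.span {f} * I').colon {f} = I' := by
  ext x
  simp only [Submodule.mem_colon_singleton, smul_eq_mul, Submodule.mem_sup,
    Ideal.mem_span_singleton_mul]
  constructor
  · rintro ⟨_, ⟨y, -, rfl⟩, _, ⟨z, hz, rfl⟩, h⟩
    obtain ⟨w, rfl⟩ : f ∣ y := hrel.dvd_of_dvd_mul_left ⟨x - z, by linear_combination h⟩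
    have hx : x = z + w * f' := mul_left_cancel₀ hf0 (by linear_combination -h)
    exact hx ▸ I'.add_mem hz (I'.mul_mem_left _ hf')
  · exact fun hx => ⟨0, ⟨0, I.zero_mem, mul_zero _⟩, f * x, ⟨x, hx, rfl⟩, by ring⟩

theorem IsFilteredBy.liaison {I I' : Ideal R} {f f' : R} (hf : f ∈ I) (hf' : f' ∈ I')
    (hrel : IsRelPrime f f') (hI : IsFilteredBy Ps I) (hI' : IsFilteredBy Ps I')
    (hff' : IsFilteredBy Ps (Ideal.span {f, f'})) :
    IsFilteredBy Ps (Ideal.span {f'} * I ⊔ Ideal.span {f} * I') := by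
  rcases eq_or_ne f 0 with rfl | hf0
  · have htop : Ideal.span {f'} = ⊤ :=
      Ideal.span_singleton_eq_top.mpr (isRelPrime_zero_left.mp hrel)
    simpa [htop] using hI
  rcases eq_or_ne f' 0 with rfl | hf0'
  · have htop : Ideal.span {f} = ⊤ :=
      Ideal.span_singleton_eq_top.mpr (isRelPrime_zero_right.mp hrel)
    simpa [htop] using hI'
  have hsup : Ideal.span {f'} * I ⊔ Ideal.span {f} * I' ⊔ Ideal.span {f} =
      Ideal.span {f} * ⊤ ⊔ Ideal.span {f'} * I := by
    rw [sup_assoc, sup_eq_right.mpr (Ideal.mul_le_left : Ideal.span {f} * I' ≤ _), Ideal.mul_top,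
      sup_comm]
  have hsup' : Ideal.span {f} * ⊤ ⊔ Ideal.span {f'} * I ⊔ Ideal.span {f'} =
      Ideal.span {f, f'} := by
    rw [sup_assoc, sup_eq_right.mpr (Ideal.mul_le_left : Ideal.span {f'} * I ≤ _), Ideal.mul_top,
      Ideal.span_insert]
  refine .of_colon f ?_ (hsup ▸ .of_colon f' ?_ (hsup' ▸ hff'))
  · rwa [colon_span_singleton_mul_sup hf0 hf' hrel]
  · rwa [colon_span_singleton_mul_sup hf0' hf hrel.symm]

theorem IsFilteredBy.span_pair_mul {f g h : R} (hfg : IsRelPrime f g)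
    (hg : IsFilteredBy Ps (Ideal.span {f, g})) (hh : IsFilteredBy Ps (Ideal.span {f, h})) :
    IsFilteredBy Ps (Ideal.span {f, g * h}) := by
  have hspan : Ideal.span {f} * ⊤ ⊔ Ideal.span {g} * Ideal.span {f, h} =
      Ideal.span {f, g * h} := by
    rw [Ideal.mul_top, Ideal.span_insert f {h}, Ideal.mul_sup, ← sup_assoc,
      sup_eq_left.mpr (Ideal.mul_le_right : Ideal.span {g} * Ideal.span {f} ≤ _),
      Ideal.span_singleton_mul_span_singleton,
      Ideal.span_insert]
  rw [← hspan]
  exact liaison Submodule.mem_top (Ideal.subset_span (by simp)) hfg.symm .top hh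
    (by rwa [Ideal.span_pair_comm])

theorem IsFilteredBy.span_pair_prod {ι : Type*} {f : R} (t : Finset ι) (m : ι → R)
    (hrel : ∀ j ∈ t, IsRelPrime f (m j)) (h : ∀ j ∈ t, IsFilteredBy Ps (Ideal.span {f, m j})) :
    IsFilteredBy Ps (Ideal.span {f, ∏ j ∈ t, m j}) := by
  classical
  induction t using Finset.induction_on with
  | empty =>
    have htop : Ideal.span {f, 1} = ⊤ :=
      (Ideal.eq_top_iff_one _).mpr (Ideal.subset_span (by simp))
    simpa only [Finset.prod_empty, htop] using IsFilteredBy.top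
  | insert j t hj ih =>
    rw [Finset.prod_insert hj]
    exact span_pair_mul (hrel j (by simp)) (h j (by simp))
      (ih (fun i hi => hrel i (by simp [hi])) fun i hi => h i (by simp [hi]))

theorem IsFilteredBy.span_prod_prod {ι κ : Type*} {s : Finset ι} {t : Finset κ} {l : ι → R}
    {m : κ → R} (hrel : ∀ i ∈ s, ∀ j ∈ t, IsRelPrime (l i) (m j))
    (h : ∀ i ∈ s, ∀ j ∈ t, IsFilteredBy Ps (Ideal.span {l i, m j})) :
    IsFilteredBy Ps (Ideal.span {∏ i ∈ s, l i, ∏ j ∈ t, m j}) := by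
  refine span_pair_prod t m (fun j hj => IsRelPrime.prod_left fun i hi => hrel i hi j hj)
    fun j hj => ?_
  rw [Ideal.span_pair_comm]
  refine span_pair_prod s l (fun i hi => (hrel i hi j hj).symm) fun i hi => ?_
  rw [Ideal.span_pair_comm]
  exact h i hi j hj

end RelPrime

theorem isRelPrime_iff_span_pair_le {a b : R} :
    IsRelPrime a b ↔ ∀ d, Ideal.span {a, b} ≤ Ideal.span {d} → IsUnit d := by
  simp [IsRelPrime, Ideal.span_le, Set.insert_subset_iff, Ideal.mem_span_singleton]

theorem IsFilteredBy.span_triangle [IsDomain R] [DecompositionMonoid R] {a b : R}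
    (h3 : IsUnit (3 : R)) (hrel : IsRelPrime a b) (h : IsFilteredBy Ps (Ideal.span {a, b})) :
    IsFilteredBy Ps (Ideal.span {b * (2 * a + b), a * (a + 2 * b)}) := by
  obtain ⟨c, hc⟩ := h3.exists_left_inv
  have hspan {x y : R} (hxy : Ideal.span {x, y} = Ideal.span {a, b}) :
      IsRelPrime x y ∧ IsFilteredBy Ps (Ideal.span {x, y}) := by
    rw [isRelPrime_iff_span_pair_le, hxy, ← isRelPrime_iff_span_pair_le]
    exact ⟨hrel, h⟩
  obtain ⟨hrel₁, h₁⟩ : IsRelPrime (a + 2 * b) b ∧ _ := hspan (Ideal.span_pair_add_mul_right ..)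
  obtain ⟨hrel₂, h₂⟩ : IsRelPrime (2 * a + b) a ∧ _ := hspan <| by
    rw [Ideal.span_pair_comm, Ideal.span_pair_mul_left_add]
  obtain ⟨-, h₃⟩ : IsRelPrime (2 * a + b) (a + 2 * b) ∧ _ := hspan <| by
    refine le_antisymm ?_ ?_ <;> rw [Ideal.span_le, Set.insert_subset_iff, Set.singleton_subset_iff]
    · exact ⟨Ideal.mem_span_pair.mpr ⟨2, 1, by ring⟩, Ideal.mem_span_pair.mpr ⟨1, 2, by ring⟩⟩
    · exact ⟨Ideal.mem_span_pair.mpr ⟨2 * c, -c, by linear_combination a * hc⟩,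
        Ideal.mem_span_pair.mpr ⟨-c, 2 * c, by linear_combination b * hc⟩⟩
  have hb : IsFilteredBy Ps (Ideal.span {b, a * (a + 2 * b)}) :=
    span_pair_mul hrel.symm (by rwa [Ideal.span_pair_comm]) (by rwa [Ideal.span_pair_comm])
  have hab : IsFilteredBy Ps (Ideal.span {2 * a + b, a * (a + 2 * b)}) :=
    span_pair_mul hrel₂ h₂ h₃
  rw [Ideal.span_pair_comm] at hb hab ⊢
  exact span_pair_mul (.mul_left hrel hrel₁) hb hab

end Filtration

section LiaisonSum

variable {R ι : Type*} [CommRing R] {f : ι → R} {I : ι → Ideal R} {s : Finset ι}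

theorem prod_mem_of_mem {Q : Ideal R} {i : ι} (hi : i ∈ s) (hf : f i ∈ Q) : ∏ j ∈ s, f j ∈ Q :=
  Ideal.mem_of_dvd Q (Finset.dvd_prod_of_mem f hi) hf

variable [DecidableEq ι]

/-- The liaison sum of the ideals `I i` along the ring elements `f i`: the ideal generated by `∏ f`
and by all the ideals `(∏ f / f i) I i`. -/
def liaisonSum (f : ι → R) (I : ι → Ideal R) (s : Finset ι) : Ideal R :=
  Ideal.span {∏ j ∈ s, f j} ⊔ ⨆ i ∈ s, Ideal.span {∏ j ∈ s.erase i, f j} * I i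

theorem prod_mem_liaisonSum : ∏ j ∈ s, f j ∈ liaisonSum f I s :=
  Ideal.mem_sup_left (Ideal.mem_span_singleton_self _)

theorem mul_mem_liaisonSum {i : ι} (hi : i ∈ s) {x : R} (hx : x ∈ I i) :
    (∏ j ∈ s.erase i, f j) * x ∈ liaisonSum f I s :=
  Ideal.mem_sup_right <| (le_iSup₂ (f := fun i _ => Ideal.span {∏ j ∈ s.erase i, f j} * I i) i hi)
    (Ideal.mul_mem_mul (Ideal.mem_span_singleton_self _) hx)

theorem liaisonSum_le {Q : Ideal R} (hprod : ∏ j ∈ s, f j ∈ Q)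
    (h : ∀ i ∈ s, ∀ x ∈ I i, (∏ j ∈ s.erase i, f j) * x ∈ Q) : liaisonSum f I s ≤ Q :=
  sup_le ((Ideal.span_singleton_le_iff_mem _).mpr hprod) <| iSup₂_le fun i hi =>
    Ideal.span_singleton_mul_le_iff.mpr (h i hi)

theorem liaisonSum_mono {I' : ι → Ideal R} (h : ∀ i, I i ≤ I' i) :
    liaisonSum f I s ≤ liaisonSum f I' s :=
  liaisonSum_le prod_mem_liaisonSum fun i hi _ hx => mul_mem_liaisonSum hi (h i hx)

theorem liaisonSum_empty : liaisonSum f I ∅ = ⊤ := by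
  simp [liaisonSum]

theorem liaisonSum_insert {i : ι} (hi : i ∉ s) : liaisonSum f I (insert i s) =
    Ideal.span {∏ j ∈ s, f j} * I i ⊔ Ideal.span {f i} * liaisonSum f I s := by
  have hsum : ⨆ j ∈ s, Ideal.span {∏ m ∈ (insert i s).erase j, f m} * I j =
      Ideal.span {f i} * ⨆ j ∈ s, Ideal.span {∏ m ∈ s.erase j, f m} * I j := by
    simp only [Ideal.mul_iSup]
    refine iSup_congr fun j => iSup_congr fun hj => ?_
    have hij : i ≠ j := fun h => hi (h ▸ hj)
    rw [Finset.erase_insert_of_ne hij, Finset.prod_insert (by simp [hi]), ← mul_assoc,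
      Ideal.span_singleton_mul_span_singleton]
  rw [liaisonSum, liaisonSum, Finset.iSup_insert, hsum, Finset.prod_insert hi,
    Finset.erase_insert hi, Ideal.mul_sup, Ideal.span_singleton_mul_span_singleton, sup_left_comm]

theorem isFilteredBy_liaisonSum [IsDomain R] [DecompositionMonoid R] {Ps : Set (Ideal R)}
    (hf : ∀ i ∈ s, f i ∈ I i) (hI : ∀ i ∈ s, IsFilteredBy Ps (I i))
    (hrel : (s : Set ι).Pairwise fun i j => IsRelPrime (f i) (f j))
    (hff : (s : Set ι).Pairwise fun i j => IsFilteredBy Ps (Ideal.span {f i, f j})) :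
    IsFilteredBy Ps (liaisonSum f I s) := by
  induction s using Finset.induction_on with
  | empty => exact liaisonSum_empty (f := f) (I := I) ▸ .top
  | insert i s hi ih =>
    have hne : ∀ j ∈ s, i ≠ j := fun j hj h => hi (h ▸ hj)
    have hmem : ∀ j ∈ s, j ∈ insert i s := fun j hj => Finset.mem_insert_of_mem hj
    have his : i ∈ insert i s := Finset.mem_insert_self i s
    rw [liaisonSum_insert hi]
    refine .liaison (hf i his) prod_mem_liaisonSum ?_ (hI i his) ?_ ?_
    · exact IsRelPrime.prod_right fun j hj => hrel his (hmem j hj) (hne j hj)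
    · exact ih (fun j hj => hf j (hmem j hj)) (fun j hj => hI j (hmem j hj))
        (hrel.mono hmem) (hff.mono hmem)
    · exact .span_pair_prod s f (fun j hj => hrel his (hmem j hj) (hne j hj))
        fun j hj => hff his (hmem j hj) (hne j hj)

theorem liaisonSum_le_of_mem {i : ι} (hi : i ∈ s) (hf : f i ∈ I i) : liaisonSum f I s ≤ I i := by
  refine liaisonSum_le (prod_mem_of_mem hi hf) fun j _ x hx => ?_
  rcases eq_or_ne i j with rfl | hne
  · exact Ideal.mul_mem_left _ _ hx
  · exact Ideal.mul_mem_right _ _ (prod_mem_of_mem (Finset.mem_erase.mpr ⟨hne, hi⟩) hf)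

theorem liaisonSum_le_of_mem_of_mem {Q : Ideal R} {i j : ι} (hi : i ∈ s) (hj : j ∈ s) (hij : i ≠ j)
    (hfi : f i ∈ Q) (hfj : f j ∈ Q) : liaisonSum f I s ≤ Q := by
  refine liaisonSum_le (prod_mem_of_mem hi hfi) fun m _ x _ => Ideal.mul_mem_right _ _ ?_
  rcases eq_or_ne i m with rfl | hne
  · exact prod_mem_of_mem (Finset.mem_erase.mpr ⟨hij.symm, hj⟩) hfj
  · exact prod_mem_of_mem (Finset.mem_erase.mpr ⟨hne, hi⟩) hfi

end LiaisonSum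

section Local

variable {R : Type*} [CommRing R] {J D K : Ideal R}

theorem exists_notMem_forall_mul_mem {P N M : Ideal R} [P.IsPrime] (hM : M.FG)
    (h : ∀ x ∈ M, ∃ s ∉ P, s * x ∈ N) : ∃ s ∉ P, ∀ x ∈ M, s * x ∈ N := by
  obtain ⟨T, rfl⟩ := hM
  choose! s hsP hs using fun x (hx : x ∈ T) => h x (Submodule.subset_span hx)
  refine ⟨∏ x ∈ T, s x, fun hP => ?_, ?_⟩
  · obtain ⟨x, hx, hsx⟩ := Ideal.IsPrime.prod_mem_iff.mp hP
    exact hsP x hx hsx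
  · suffices hle : Submodule.span R T ≤ N.colon {∏ x ∈ T, s x} from fun x hx => by
      simpa [mul_comm] using Submodule.mem_colon_singleton.mp (hle hx)
    refine Submodule.span_le.mpr fun x hx => Submodule.mem_colon_singleton.mpr ?_
    rw [smul_eq_mul, mul_comm]
    exact Ideal.mem_of_dvd N (mul_dvd_mul_right (Finset.dvd_prod_of_mem s hx) x) (hs x hx)

/-- Nakayama's lemma at `P`, where `h` is invertible. -/
theorem exists_notMem_forall_mul_mem_of_mul_mem_sup {P N M : Ideal R} [P.IsPrime] (hM : M.FG)
    {h : R} (hP : h ∉ P) (hle : ∀ x ∈ M, h * x ∈ N ⊔ P * M) : ∃ s ∉ P, ∀ x ∈ M, s * x ∈ N := by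
  let φ := algebraMap R (Localization.AtPrime P)
  have hmap : M.map φ ≤ N.map φ ⊔ P.map φ • M.map φ := by
    refine Ideal.map_le_iff_le_comap.mpr fun x hx => Ideal.mem_comap.mpr ?_
    have hmem := Ideal.mem_map_of_mem φ (hle x hx)
    rw [map_mul, Ideal.map_sup, Ideal.map_mul] at hmem
    exact (Ideal.unit_mul_mem_iff_mem _ (IsLocalization.map_units _ (⟨h, hP⟩ : P.primeCompl))).mp
      hmem
  have hjac : P.map φ ≤ Ideal.jacobson ⊥ := by
    rw [Localization.AtPrime.map_eq_maximalIdeal]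
    exact IsLocalRing.maximalIdeal_le_jacobson _
  have hMN : M.map φ ≤ N.map φ := Submodule.le_of_le_smul_of_le_jacobson_bot (hM.map φ) hjac hmap
  refine exists_notMem_forall_mul_mem hM fun x hx => ?_
  exact (IsLocalization.algebraMap_mem_map_algebraMap_iff P.primeCompl _ N x).mp
    (hMN (Ideal.mem_map_of_mem φ hx))

theorem radical_eq_of_isFilteredBy_minimalPrimes (hD : IsFilteredBy J.minimalPrimes D)
    (hDP : ∀ P ∈ J.minimalPrimes, D ≤ P)
    (hloc : ∀ P ∈ J.minimalPrimes, ∃ s ∉ P, ∀ x ∈ P, s * x ∈ D) : J.radical = D := by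
  rw [← J.sInf_minimalPrimes]
  refine le_antisymm (fun x hx => ?_) (le_sInf hDP)
  refine hD.mem_of_forall_exists_mul_mem (fun P hP => hP.1.1) fun P hP => ?_
  exact (hloc P hP).imp fun s hs => ⟨hs.1, hs.2 x (Submodule.mem_sInf.mp hx P hP)⟩

theorem IsHeightTwoPart.exists_mul_mem (hK : IsHeightTwoPart J K) {P : Ideal R}
    (hP : P ∈ J.minimalPrimes) (hht : P.height = 2) {x : R} (hx : x ∈ K) :
    ∃ s ∉ P, s * x ∈ J := by
  obtain ⟨t, ht, rfl⟩ := hK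
  have hprime : P.IsPrime := hP.1.1
  have hloc : ∀ q ∈ t, ∃ s ∉ P, s * x ∈ q := fun q hq => by
    by_cases hqP : q.radical ≤ P
    · have hJq : J ≤ q.radical := ht.inf_eq ▸ (Finset.inf_le hq).trans Ideal.le_radical
      have hrad : q.radical = P :=
        hqP.antisymm (hP.2 ⟨Ideal.isPrime_radical (ht.primary hq), hJq⟩ hqP)
      refine ⟨1, (Ideal.ne_top_iff_one P).mp hprime.ne_top, ?_⟩
      rw [one_mul]
      exact (Submodule.mem_iInf _).mp ((Submodule.mem_iInf _).mp hx q) ⟨hq, hrad ▸ hht⟩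
    · obtain ⟨s, ⟨n, hn⟩, hsP⟩ := SetLike.not_le_iff_exists.mp hqP
      exact ⟨s ^ n, fun h => hsP (hprime.mem_of_pow_mem n h), Ideal.mul_mem_right _ _ hn⟩
  choose! s hsP hsx using hloc
  refine ⟨∏ q ∈ t, s q, fun h => ?_, ?_⟩
  · obtain ⟨q, hq, h⟩ := Ideal.IsPrime.prod_mem_iff.mp h
    exact hsP q hq h
  · rw [← ht.inf_eq, Submodule.mem_finsetInf]
    exact fun q hq =>
      Ideal.mem_of_dvd q (mul_dvd_mul_right (Finset.dvd_prod_of_mem s hq) x) (hsx q hq)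

theorem IsHeightTwoPart.eq_of_isFilteredBy_minimalPrimes [IsNoetherianRing R]
    (hK : IsHeightTwoPart J K)
    (hht : ∀ P ∈ J.minimalPrimes, P.height = 2) (hD : IsFilteredBy J.minimalPrimes D) (hJD : J ≤ D)
    (hloc : ∀ P ∈ J.minimalPrimes, ∃ s ∉ P, ∀ x ∈ D, s * x ∈ J) : K = D := by
  apply le_antisymm
  · refine fun x hx => hD.mem_of_forall_exists_mul_mem (fun P hP => hP.1.1) fun P hP => ?_
    exact (hK.exists_mul_mem hP (hht P hP) hx).imp fun s hs => ⟨hs.1, hJD hs.2⟩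
  · obtain ⟨t, ht, rfl⟩ := hK
    refine le_iInf₂ fun q ⟨hq, hq2⟩ x hx => ?_
    have hJq : J ≤ q := ht.inf_eq ▸ Finset.inf_le hq
    have hprimary : q.IsPrimary := ht.primary hq
    have := Ideal.isPrime_radical hprimary
    obtain ⟨P, hP, hle⟩ := Ideal.exists_minimalPrimes_le (hJq.trans Ideal.le_radical)
    have := hP.1.1
    have hrad : P = q.radical := Ideal.eq_of_le_of_height_le _ hle (by rw [hht P hP, hq2])
    obtain ⟨s, hs, h⟩ := hloc P hP
    refine ((Ideal.isPrimary_iff.mp hprimary).2 (x := x) (y := s) ?_).resolve_right (hrad ▸ hs)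
    exact mul_comm s x ▸ hJq (h x hx)

theorem IsHeightTwoPart.eq_top_of_height_ne_two [J.IsPrime] (hK : IsHeightTwoPart J K)
    (hJ : J.height ≠ 2) : K = ⊤ := by
  obtain ⟨t, ht, rfl⟩ := hK
  obtain ⟨q₀, hq₀, (hle : q₀ ≤ J)⟩ := (Ideal.IsPrime.inf_le' ‹_›).mp ht.inf_eq.le
  have hmem {q : Ideal R} (hq : q ∈ t) : J ≤ q := ht.inf_eq ▸ Finset.inf_le hq
  refine iInf₂_eq_top.mpr fun q ⟨hqt, hq⟩ => absurd hq ?_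
  obtain rfl : q = q₀ := by
    by_contra hne
    exact ht.minimal hqt <| (Finset.inf_le (Finset.mem_erase.mpr ⟨Ne.symm hne, hq₀⟩)).trans <|
      hle.trans (hmem hqt)
  rwa [le_antisymm hle (hmem hqt), Ideal.IsPrime.radical ‹_›]

end Local

section CommonComplement

open Module

variable {k V ι : Type*} [Field k] [Infinite k] [AddCommGroup V] [Module k V]
  [Finite ι]

theorem exists_forall_notMem (U : ι → Submodule k V) (hU : ∀ i, U i ≠ ⊤) :
    ∃ v, ∀ i, v ∉ U i := by
  by_contra! h
  obtain ⟨i, hi⟩ := Subspace.exists_eq_top_of_iUnion_eq_univ (p := U)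
    (Set.eq_univ_of_forall fun v => Set.mem_iUnion.mpr (h v))
  exact hU i hi

theorem exists_forall_isCompl [FiniteDimensional k V] (U : ι → Submodule k V) {c : ℕ}
    (hU : ∀ i, finrank k (U i) + c = finrank k V) : ∃ W, ∀ i, IsCompl W (U i) := by
  induction c generalizing U with
  | zero =>
    exact ⟨⊥, fun i => Submodule.eq_top_of_finrank_eq (hU i) ▸ isCompl_bot_top⟩
  | succ c ih =>
    have htop : ∀ i, U i ≠ ⊤ := fun i h => by
      have := hU i
      rw [h, finrank_top] at this
      omega
    obtain ⟨v, hv⟩ := exists_forall_notMem U htop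
    have hdisj : ∀ i, Disjoint (Submodule.span k {v}) (U i) := fun i =>
      (Submodule.disjoint_span_singleton_of_notMem (hv i)).symm
    have hv0 : ∀ _ : ι, v ≠ 0 := fun i h => hv i (h ▸ zero_mem _)
    obtain ⟨W, hW⟩ := ih (fun i => Submodule.span k {v} ⊔ U i) fun i => by
      have hsum := Submodule.finrank_sup_add_finrank_inf_eq (Submodule.span k {v}) (U i)
      rw [(hdisj i).eq_bot, finrank_bot, finrank_span_singleton (hv0 i)] at hsum
      have := hU i
      omega
    refine ⟨W ⊔ Submodule.span k {v}, fun i => ⟨?_, ?_⟩⟩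
    · exact Disjoint.disjoint_sup_left_of_disjoint_sup_right (hdisj i) (hW i).disjoint
    · exact codisjoint_assoc.mpr (hW i).codisjoint

end CommonComplement

section LinearIdeal

open MvPolynomial Module

variable {k σ : Type*} [Field k] [Fintype σ]

/-- The linear form with the given coefficient vector. -/
noncomputable def linForm : (σ → k) →ₗ[k] MvPolynomial σ k :=
  Fintype.linearCombination k X

/-- The ideal generated by a space of linear forms: the ideal of the linear subspace on which these
forms vanish. -/
noncomputable def linearIdeal (U : Submodule k (σ → k)) : Ideal (MvPolynomial σ k) :=
  Ideal.span (linForm '' U)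

variable {U W : Submodule k (σ → k)} {u v : σ → k}

theorem linForm_single [DecidableEq σ] (i : σ) : linForm (Pi.single i (1 : k)) = X i := by
  simp [linForm]

theorem linearIdeal_span (s : Set (σ → k)) :
    linearIdeal (Submodule.span k s) = Ideal.span (linForm '' s) := by
  refine le_antisymm (Ideal.span_le.mpr ?_) (Ideal.span_mono (Set.image_mono Submodule.subset_span))
  rw [← Submodule.map_coe, ← Submodule.span_image]
  exact Submodule.span_le_restrictScalars k _ _

theorem linearIdeal_span_pair : linearIdeal (Submodule.span k {u, v}) =
    Ideal.span {linForm u, linForm v} := by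
  rw [linearIdeal_span, Set.image_pair]

/-- The polynomial ring on a basis of `W`, mapped into the polynomial ring on all variables. -/
noncomputable def subspaceAlgHom (W : Submodule k (σ → k)) :
    MvPolynomial (Fin (finrank k W)) k →ₐ[k] MvPolynomial σ k :=
  aeval fun j => linForm (finBasis k W j : σ → k)

theorem subspaceAlgHom_constr (w : W) :
    subspaceAlgHom W ((finBasis k W).constr k X w) = linForm (w : σ → k) := by
  have h : (subspaceAlgHom W).toLinearMap ∘ₗ (finBasis k W).constr k X =
      linForm ∘ₗ W.subtype := (finBasis k W).ext fun j => by
    simp [subspaceAlgHom]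
  exact LinearMap.congr_fun h w

theorem aeval_linForm {A : Type*} [CommRing A] [Algebra k A] [DecidableEq σ]
    (g : (σ → k) →ₗ[k] A) :
    aeval (R := k) (fun i => g (Pi.single i 1)) (linForm v : MvPolynomial σ k) = g v := by
  have h : (aeval (R := k) (fun i => g (Pi.single i 1)) : MvPolynomial σ k →ₐ[k] A).toLinearMap ∘ₗ
      linForm = g :=
    LinearMap.pi_ext' fun i => LinearMap.ext_ring (by simp [linForm_single])
  exact LinearMap.congr_fun h v

theorem linForm_mem_linearIdeal (hu : u ∈ U) : linForm u ∈ linearIdeal U :=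
  Ideal.subset_span ⟨u, hu, rfl⟩

theorem linForm_injective : Function.Injective (linForm : (σ → k) →ₗ[k] MvPolynomial σ k) :=
  (linearIndependent_X σ k).fintypeLinearCombination_injective

theorem exists_retraction_subspaceAlgHom (h : IsCompl W U) :
    ∃ ψ : MvPolynomial σ k →ₐ[k] MvPolynomial (Fin (finrank k W)) k,
      Function.LeftInverse ψ (subspaceAlgHom W) ∧ RingHom.ker ψ = linearIdeal U ∧
        ∀ v, ψ (linForm v) = 0 ↔ v ∈ U := by
  classical
  let π := W.projectionOnto U h
  let lin : W →ₗ[k] MvPolynomial (Fin (finrank k W)) k := (finBasis k W).constr k X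
  let ψ : MvPolynomial σ k →ₐ[k] MvPolynomial (Fin (finrank k W)) k :=
    aeval fun i => (lin ∘ₗ π) (Pi.single i 1)
  have hψ : ∀ v, ψ (linForm v) = lin (π v) := fun v => aeval_linForm _
  have hinv : Function.LeftInverse ψ (subspaceAlgHom W) := by
    have hcomp : ψ.comp (subspaceAlgHom W) = AlgHom.id k _ :=
      MvPolynomial.algHom_ext fun j => by simp [subspaceAlgHom, hψ, π, lin]
    exact AlgHom.congr_fun hcomp
  have hzero : ∀ v, ψ (linForm v) = 0 ↔ v ∈ U := fun v => by
    rw [← map_eq_zero_iff _ hinv.injective, hψ, subspaceAlgHom_constr,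
      map_eq_zero_iff _ linForm_injective, ZeroMemClass.coe_eq_zero,
      Submodule.projectionOnto_apply_eq_zero_iff]
  have hsub : ∀ r, r - subspaceAlgHom W (ψ r) ∈ linearIdeal U := fun r => by
    have hcomp : Ideal.Quotient.mkₐ k (linearIdeal U) =
        (Ideal.Quotient.mkₐ k (linearIdeal U)).comp ((subspaceAlgHom W).comp ψ) :=
      MvPolynomial.algHom_ext fun i => by
        rw [← linForm_single, AlgHom.comp_apply, AlgHom.comp_apply, hψ, subspaceAlgHom_constr]
        refine Ideal.Quotient.eq.mpr ?_
        rw [← map_sub]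
        refine linForm_mem_linearIdeal ?_
        rw [← Submodule.projectionOnto_apply_eq_zero_iff h, map_sub, sub_eq_zero]
        exact (Submodule.projectionOnto_apply_left h _).symm
    exact Ideal.Quotient.eq.mp (AlgHom.congr_fun hcomp r)
  refine ⟨ψ, hinv, le_antisymm (fun r hr => ?_) (Ideal.span_le.mpr ?_), hzero⟩
  · simpa [RingHom.mem_ker.mp hr] using hsub r
  · rintro _ ⟨v, hv, rfl⟩
    exact (hzero v).mpr hv

theorem linearIdeal_isPrime (U : Submodule k (σ → k)) : (linearIdeal U).IsPrime := by
  obtain ⟨W, hW⟩ := U.exists_isCompl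
  obtain ⟨ψ, -, hker, -⟩ := exists_retraction_subspaceAlgHom hW.symm
  exact hker ▸ RingHom.ker_isPrime ψ

theorem linForm_mem_linearIdeal_iff : linForm v ∈ linearIdeal U ↔ v ∈ U := by
  obtain ⟨W, hW⟩ := U.exists_isCompl
  obtain ⟨ψ, -, hker, hzero⟩ := exists_retraction_subspaceAlgHom hW.symm
  rw [← hker, ← hzero v, RingHom.mem_ker]

theorem finite_projective_quotient_linearIdeal (h : IsCompl W U) :
    letI := (subspaceAlgHom W).toAlgebra
    Module.Finite (MvPolynomial (Fin (finrank k W)) k) (MvPolynomial σ k ⧸ linearIdeal U) ∧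
      Module.Projective (MvPolynomial (Fin (finrank k W)) k)
        (MvPolynomial σ k ⧸ linearIdeal U) := by
  let := (subspaceAlgHom W).toAlgebra
  obtain ⟨ψ, hinv, hker, -⟩ := exists_retraction_subspaceAlgHom h
  have hbij : Function.Bijective (Algebra.linearMap (MvPolynomial (Fin (finrank k W)) k)
      (MvPolynomial σ k ⧸ linearIdeal U)) := by
    constructor
    · refine (injective_iff_map_eq_zero _).mpr fun a ha => ?_
      have hmem : subspaceAlgHom W a ∈ linearIdeal U := Ideal.Quotient.eq_zero_iff_mem.mp ha
      rwa [← hker, RingHom.mem_ker, hinv a] at hmem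
    · intro r
      obtain ⟨r, rfl⟩ := Ideal.Quotient.mk_surjective r
      refine ⟨ψ r, Ideal.Quotient.eq.mpr ?_⟩
      rw [← hker, RingHom.mem_ker, map_sub, sub_eq_zero]
      exact hinv (ψ r)
  let e := LinearEquiv.ofBijective _ hbij
  exact ⟨Module.Finite.equiv e, Module.Projective.of_equiv e⟩

theorem linearIdeal_strictMono :
    StrictMono (linearIdeal : Submodule k (σ → k) → Ideal (MvPolynomial σ k)) := fun U V h => by
  obtain ⟨hle, v, hV, hU⟩ := SetLike.lt_iff_le_and_exists.mp h
  exact SetLike.lt_iff_le_and_exists.mpr ⟨Ideal.span_mono (Set.image_mono hle), linForm v,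
    linForm_mem_linearIdeal hV, mt linForm_mem_linearIdeal_iff.mp hU⟩

theorem height_linearIdeal (U : Submodule k (σ → k)) : (linearIdeal U).height = finrank k U := by
  have := linearIdeal_isPrime U
  apply le_antisymm
  · classical
    let b := finBasis k U
    let t : Finset (MvPolynomial σ k) := Finset.univ.image fun j => linForm (b j : σ → k)
    have hspan : Submodule.span k (Set.range fun j => (b j : σ → k)) = U := by
      have h := congrArg (Submodule.map U.subtype) b.span_eq
      rwa [Submodule.map_span, ← Set.range_comp, Submodule.map_subtype_top] at h
    have ht : linearIdeal U ∈ (Ideal.span (t : Set (MvPolynomial σ k))).minimalPrimes := by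
      have hU : Ideal.span (t : Set (MvPolynomial σ k)) = linearIdeal U := by
        rw [← hspan, linearIdeal_span, Finset.coe_image, Finset.coe_univ, Set.image_univ,
          ← Set.range_comp, Function.comp_def]
      rw [hU, Ideal.minimalPrimes_eq_subsingleton_self]
      exact rfl
    refine (Ideal.height_le_card_of_mem_minimalPrimes_span_finset ht).trans ?_
    exact_mod_cast Finset.card_image_le.trans (Finset.card_fin _).le
  · let f : Submodule k U → PrimeSpectrum (MvPolynomial σ k) := fun V =>
      ⟨linearIdeal (V.map U.subtype), linearIdeal_isPrime _⟩
    have hf : StrictMono f := fun V V' hlt => by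
      refine linearIdeal_strictMono ?_
      exact Submodule.map_strictMono_of_injective U.injective_subtype hlt
    calc (finrank k U : ℕ∞) = Order.height (⊤ : Submodule k U) := by
          rw [← length_eq_finrank k, length_eq_height]
      _ ≤ Order.height (f ⊤) := Order.height_le_height_apply_of_strictMono f hf ⊤
      _ = (linearIdeal U).height := by
          rw [← PrimeSpectrum.height_eq_orderHeight]
          exact congrArg (fun V => (linearIdeal V).height) (Submodule.map_subtype_top U)

theorem prime_linForm (hu : u ≠ 0) : Prime (linForm u) := by
  rw [← Ideal.span_singleton_prime ((map_ne_zero_iff _ linForm_injective).mpr hu),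
    ← Set.image_singleton, ← linearIdeal_span]
  exact linearIdeal_isPrime _

theorem isRelPrime_linForm (h : LinearIndependent k ![u, v]) :
    IsRelPrime (linForm u) (linForm v) := by
  refine (prime_linForm (h.ne_zero 0)).irreducible.isRelPrime_iff_not_dvd.mpr fun hdvd => ?_
  rw [← Ideal.mem_span_singleton, ← Set.image_singleton, ← linearIdeal_span,
    linForm_mem_linearIdeal_iff, Submodule.mem_span_singleton] at hdvd
  obtain ⟨a, ha⟩ := hdvd
  exact (LinearIndependent.pair_iff' (h.ne_zero 0)).mp h a ha

end LinearIdeal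

section Jacobian

open MvPolynomial

variable {k : Type*} [Field k] {n : ℕ} {F f H : MvPolynomial (Fin n) k}

theorem derivation_apply_mem_jacobianIdeal
    (D : Derivation k (MvPolynomial (Fin n) k) (MvPolynomial (Fin n) k)) :
    D F ∈ jacobianIdeal F := by
  have hD : D F = ∑ i, D (X i) * pderiv i F := by
    induction F using MvPolynomial.induction_on with
    | C a => simp [← algebraMap_eq]
    | add p q hp hq => simp only [map_add, hp, hq, mul_add, Finset.sum_add_distrib]
    | mul_X p j hp =>
      simp [hp, pderiv_X, Pi.single_apply, mul_add, Finset.sum_add_distrib, Finset.mul_sum,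
        mul_comm p, mul_left_comm (X j)]
  rw [hD]
  exact sum_mem fun i _ => Ideal.mul_mem_left _ _ (Ideal.subset_span ⟨i, rfl⟩)

theorem jacobianIdeal_le {I : Ideal (MvPolynomial (Fin n) k)}
    (h : ∀ D : Derivation k (MvPolynomial (Fin n) k) (MvPolynomial (Fin n) k), D F ∈ I) :
    jacobianIdeal F ≤ I :=
  Ideal.span_le.mpr (Set.range_subset_iff.mpr fun i => h (pderiv i))

theorem mem_jacobianIdeal_of_isHomogeneous {d : ℕ} (hF : F.IsHomogeneous d) (hd : (d : k) ≠ 0) :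
    F ∈ jacobianIdeal F := by
  have hsum : C (d : k) * F ∈ jacobianIdeal F := by
    rw [map_natCast, ← nsmul_eq_mul, ← hF.sum_X_mul_pderiv]
    exact sum_mem fun i _ => Ideal.mul_mem_left _ _ (Ideal.subset_span ⟨i, rfl⟩)
  exact (Ideal.unit_mul_mem_iff_mem _ (hd.isUnit.map C)).mp hsum

theorem jacobianIdeal_C_mul {c : k} (hc : c ≠ 0) : jacobianIdeal (C c * F) = jacobianIdeal F := by
  have hD (D : Derivation k (MvPolynomial (Fin n) k) (MvPolynomial (Fin n) k)) :
      D (C c * F) = C c * D F := by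
    rw [← smul_eq_C_mul, D.map_smul, smul_eq_C_mul]
  refine le_antisymm (jacobianIdeal_le fun D => ?_) (jacobianIdeal_le fun D => ?_)
  · exact hD D ▸ Ideal.mul_mem_left _ _ (derivation_apply_mem_jacobianIdeal D)
  · rw [← Ideal.unit_mul_mem_iff_mem _ (hc.isUnit.map C), ← hD]
    exact derivation_apply_mem_jacobianIdeal D

theorem jacobianIdeal_prod_le {ι : Type*} [DecidableEq ι] (s : Finset ι)
    (f : ι → MvPolynomial (Fin n) k) :
    jacobianIdeal (∏ i ∈ s, f i) ≤ liaisonSum f (fun i => jacobianIdeal (f i)) s := by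
  refine jacobianIdeal_le fun D => ?_
  induction s using Finset.induction_on with
  | empty => simp
  | insert i s hi ih =>
    rw [Finset.prod_insert hi, liaisonSum_insert hi, D.leibniz, smul_eq_mul, smul_eq_mul, add_comm]
    exact Submodule.add_mem_sup
      (Ideal.mul_mem_mul (Ideal.mem_span_singleton_self _) (derivation_apply_mem_jacobianIdeal D))
      (Ideal.mul_mem_mul (Ideal.mem_span_singleton_self _) ih)

/-- Differentiating `f * H` shows `H • J(f) ≤ J(f * H) + P • J(f)`; Nakayama does the rest. -/
theorem exists_notMem_forall_mul_mem_jacobianIdeal_mul {P : Ideal (MvPolynomial (Fin n) k)}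
    [P.IsPrime] (hf : f ∈ P * jacobianIdeal f) (hH : H ∉ P) :
    ∃ s ∉ P, ∀ x ∈ jacobianIdeal f, s * x ∈ jacobianIdeal (f * H) := by
  refine exists_notMem_forall_mul_mem_of_mul_mem_sup (IsNoetherian.noetherian _) hH fun x hx => ?_
  suffices hle : jacobianIdeal f ≤
      (jacobianIdeal (f * H) ⊔ P * jacobianIdeal f).colon {H} by
    exact mul_comm x H ▸ Submodule.mem_colon_singleton.mp (hle hx)
  refine jacobianIdeal_le fun D => Submodule.mem_colon_singleton.mpr ?_
  have hD : D f • H = D (f * H) - D H * f := by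
    simp only [D.leibniz, smul_eq_mul]
    ring
  rw [hD]
  exact sub_mem (Ideal.mem_sup_left (derivation_apply_mem_jacobianIdeal D))
    (Ideal.mem_sup_right (Ideal.mul_mem_left _ _ hf))

section LinearForms

variable {u v : Fin n → k}

theorem notMem_span_singleton_of_linearIndependent {V : Type*} [AddCommGroup V] [Module k V]
    {u v : V} (huv : LinearIndependent k ![u, v]) : v ∉ Submodule.span k {u} := fun h =>
  have ⟨c, hc⟩ := Submodule.mem_span_singleton.mp h
  (LinearIndependent.pair_iff' (huv.ne_zero 0)).mp huv c hc

theorem exists_derivation_linForm {σ : Type*} [Fintype σ] {U : Submodule k (σ → k)} {v : σ → k}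
    (hv : v ∉ U) : ∃ D : Derivation k (MvPolynomial σ k) (MvPolynomial σ k),
      D (linForm v) = 1 ∧ ∀ u ∈ U, D (linForm u) = 0 := by
  classical
  obtain ⟨φ, hφv, hφU⟩ := U.exists_dual_map_eq_bot_of_notMem hv inferInstance
  let D := mkDerivation k fun i => C (σ := σ) ((φ v)⁻¹ * φ (Pi.single i 1))
  have hD : ∀ w, D (linForm w) = C ((φ v)⁻¹ * φ w) := fun w => by
    have h : D.toLinearMap ∘ₗ linForm =
        (Algebra.linearMap k (MvPolynomial σ k)) ∘ₗ ((φ v)⁻¹ • φ) :=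
      LinearMap.pi_ext' fun i => LinearMap.ext_ring (by simp [linForm_single, D, algebraMap_eq])
    exact LinearMap.congr_fun h w
  refine ⟨D, by rw [hD, inv_mul_cancel₀ hφv, map_one], fun u hu => ?_⟩
  have hφu : φ u = 0 := (Submodule.mem_bot k).mp (hφU ▸ Submodule.mem_map_of_mem hu)
  rw [hD, hφu, mul_zero, map_zero]

theorem jacobianIdeal_linForm (hu : u ≠ 0) : jacobianIdeal (linForm u) = ⊤ := by
  obtain ⟨D, hD, -⟩ := exists_derivation_linForm (mt (Submodule.mem_bot k).mp hu)
  exact (Ideal.eq_top_iff_one _).mpr (hD ▸ derivation_apply_mem_jacobianIdeal D)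

/-- `x` and `y` stand for the partial derivatives of `F`, seen as a polynomial in the two forms. -/
theorem jacobianIdeal_eq_span_pair (huv : LinearIndependent k ![u, v])
    {x y : MvPolynomial (Fin n) k}
    (hF : ∀ D : Derivation k (MvPolynomial (Fin n) k) (MvPolynomial (Fin n) k),
      D F = D (linForm u) * x + D (linForm v) * y) :
    jacobianIdeal F = Ideal.span {x, y} := by
  have hu : u ∉ Submodule.span k {v} := notMem_span_singleton_of_linearIndependent
    (LinearIndependent.pair_symm_iff.mp huv)
  have hv : v ∉ Submodule.span k {u} := notMem_span_singleton_of_linearIndependent huv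
  refine le_antisymm (jacobianIdeal_le fun D => hF D ▸ Ideal.mem_span_pair.mpr ⟨_, _, rfl⟩) ?_
  rw [Ideal.span_le, Set.pair_subset_iff]
  obtain ⟨D, hDu, hDv⟩ := exists_derivation_linForm hu
  obtain ⟨D', hDv', hDu'⟩ := exists_derivation_linForm hv
  constructor
  · simpa [hF, hDu, hDv v (Submodule.mem_span_singleton_self v)] using
      derivation_apply_mem_jacobianIdeal (F := F) D
  · simpa [hF, hDv', hDu' u (Submodule.mem_span_singleton_self u)] using
      derivation_apply_mem_jacobianIdeal (F := F) D'

theorem jacobianIdeal_linForm_mul (huv : LinearIndependent k ![u, v]) :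
    jacobianIdeal (linForm u * linForm v) = Ideal.span {linForm u, linForm v} := by
  rw [Ideal.span_pair_comm]
  refine jacobianIdeal_eq_span_pair huv fun D => ?_
  simp only [D.leibniz, smul_eq_mul]
  ring

theorem jacobianIdeal_triangle (huv : LinearIndependent k ![u, v]) :
    jacobianIdeal (linForm u * linForm v * linForm (u + v)) =
      Ideal.span {linForm v * (2 * linForm u + linForm v),
        linForm u * (linForm u + 2 * linForm v)} := by
  refine jacobianIdeal_eq_span_pair huv fun D => ?_
  simp only [D.leibniz, smul_eq_mul, map_add]
  ring

/-- Euler's formula for the cubic form `a * b * (a + b)`. -/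
theorem triangle_mem_mul {R : Type*} [CommRing R] (h3 : IsUnit (3 : R)) (a b : R) :
    a * b * (a + b) ∈ Ideal.span {a, b} * Ideal.span {b * (2 * a + b), a * (a + 2 * b)} := by
  have h : 3 * (a * b * (a + b)) = a * (b * (2 * a + b)) + b * (a * (a + 2 * b)) := by ring
  rw [← Ideal.unit_mul_mem_iff_mem _ h3, h]
  exact add_mem
    (Ideal.mul_mem_mul (Ideal.subset_span (by simp)) (Ideal.subset_span (by simp)))
    (Ideal.mul_mem_mul (Ideal.subset_span (by simp)) (Ideal.subset_span (by simp)))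

theorem radical_span_triangle {R : Type*} [CommRing R] (h3 : IsUnit (3 : R)) {a b : R}
    (hP : (Ideal.span {a, b}).IsPrime) :
    (Ideal.span {b * (2 * a + b), a * (a + 2 * b)}).radical = Ideal.span {a, b} := by
  apply le_antisymm
  · rw [hP.radical_le_iff, Ideal.span_le, Set.pair_subset_iff]
    exact ⟨Ideal.mul_mem_right _ _ (Ideal.subset_span (by simp)),
      Ideal.mul_mem_right _ _ (Ideal.subset_span (by simp))⟩
  · rw [Ideal.span_le, Set.pair_subset_iff]
    constructor <;> refine ⟨3, (Ideal.unit_mul_mem_iff_mem _ h3).mp ?_⟩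
    · exact Ideal.mem_span_pair.mpr ⟨-4 * a, 3 * a + 2 * b, by ring⟩
    · exact Ideal.mem_span_pair.mpr ⟨2 * a + 3 * b, -4 * b, by ring⟩

end LinearForms

end Jacobian

section Arrangement

open MvPolynomial

variable {k ι : Type*} [Field k] {n : ℕ} {ℓ : ι → Fin n → k} {u v w : ι} {s t : Finset ι}

/-- The triples of hyperplanes, in the arrangement with normal vectors `ℓ`, whose normal vectors are
linearly dependent. -/
def collinearTriples (ℓ : ι → Fin n → k) : Set (Finset ι) :=
  {t | t.card = 3 ∧ ¬ LinearIndepOn k ℓ (t : Set ι)}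

/-- An arrangement of pairwise distinct hyperplanes in which no hyperplane lies in two collinear
triples. -/
structure HasDisjointTriples (ℓ : ι → Fin n → k) : Prop where
  ne_zero : ∀ i, ℓ i ≠ 0
  linearIndependent : ∀ ⦃i j⦄, i ≠ j → LinearIndependent k ![ℓ i, ℓ j]
  pairwiseDisjoint : (collinearTriples ℓ).PairwiseDisjoint id

/-- The ideals of the codimension-two flats of the arrangement. -/
def flatIdeals (ℓ : ι → Fin n → k) : Set (Ideal (MvPolynomial (Fin n) k)) :=
  {P | ∃ u v, u ≠ v ∧ P = linearIdeal (Submodule.span k {ℓ u, ℓ v})}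

/-- The defining polynomial of the subarrangement of the hyperplanes in `t`. -/
noncomputable def blockForm (ℓ : ι → Fin n → k) (t : Finset ι) : MvPolynomial (Fin n) k :=
  ∏ i ∈ t, linForm (ℓ i)

open Classical in
/-- The partition of the hyperplanes into the collinear triples and the remaining singletons. -/
noncomputable def blocks [Fintype ι] (ℓ : ι → Fin n → k) : Finset (Finset ι) :=
  {t | t ∈ collinearTriples ℓ ∨ t.card = 1 ∧ ∀ c ∈ collinearTriples ℓ, Disjoint t c}

theorem exists_ne_mem_of_mem_collinearTriples (ht : t ∈ collinearTriples ℓ) :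
    ∃ u ∈ t, ∃ v ∈ t, u ≠ v :=
  Finset.one_lt_card.mp (ht.1 ▸ by decide)

theorem exists_eq_insert_pair_of_card_eq_three [DecidableEq ι] (ht : t.card = 3) (hu : u ∈ t)
    (hv : v ∈ t) (huv : u ≠ v) : ∃ w, w ≠ u ∧ w ≠ v ∧ t = {w, u, v} := by
  obtain ⟨w, hwt, hw⟩ := Finset.exists_mem_notMem_of_card_lt_card
    (show ({u, v} : Finset ι).card < t.card by rw [ht, Finset.card_pair huv]; decide)
  simp only [Finset.mem_insert, Finset.mem_singleton, not_or] at hw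
  refine ⟨w, hw.1, hw.2, (Finset.eq_of_subset_of_card_le ?_ ?_).symm⟩
  · simp [Finset.insert_subset_iff, hwt, hu, hv]
  · rw [ht, Finset.card_eq_three.mpr ⟨w, u, v, hw.1, hw.2, huv, rfl⟩]

theorem mem_span_pair_iff [DecidableEq ι] (h : LinearIndependent k ![ℓ u, ℓ v]) (hwu : w ≠ u)
    (hwv : w ≠ v) : ℓ w ∈ Submodule.span k {ℓ u, ℓ v} ↔ {w, u, v} ∈ collinearTriples ℓ := by
  have huv : u ≠ v := fun huv => by simpa [huv] using LinearIndependent.pair_iff.mp h 1 (-1)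
  have hpair : LinearIndepOn k ℓ {u, v} :=
    (LinearIndepOn.pair_iff ℓ huv).mpr (LinearIndependent.pair_iff.mp h)
  have hcard : ({w, u, v} : Finset ι).card = 3 :=
    Finset.card_eq_three.mpr ⟨w, u, v, hwu, hwv, huv, rfl⟩
  simp [collinearTriples, linearIndepOn_insert, hwu, hwv, hpair, hcard, Set.image_pair]

theorem isUnit_three {σ : Type*} (h3 : (3 : k) ≠ 0) : IsUnit (3 : MvPolynomial σ k) :=
  map_ofNat (C : k →+* MvPolynomial σ k) 3 ▸ h3.isUnit.map C

theorem mem_blocks [Fintype ι] : t ∈ blocks ℓ ↔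
    t ∈ collinearTriples ℓ ∨ t.card = 1 ∧ ∀ c ∈ collinearTriples ℓ, Disjoint t c := by
  simp [blocks]

theorem exists_mem_blocks [Fintype ι] (ℓ : ι → Fin n → k) (u : ι) : ∃ t ∈ blocks ℓ, u ∈ t := by
  by_cases h : ∃ t ∈ collinearTriples ℓ, u ∈ t
  · exact h.imp fun t ht => ⟨mem_blocks.mpr (.inl ht.1), ht.2⟩
  · push Not at h
    exact ⟨{u}, mem_blocks.mpr (.inr (by simpa using h)), Finset.mem_singleton_self u⟩

namespace HasDisjointTriples

variable (hℓ : HasDisjointTriples ℓ)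
include hℓ

theorem eq_of_mem_collinearTriples (hs : s ∈ collinearTriples ℓ)
    (ht : t ∈ collinearTriples ℓ) (hus : u ∈ s) (hut : u ∈ t) : s = t :=
  hℓ.pairwiseDisjoint.elim_finset hs ht u hus hut

/-- The two forms are rescaled so that their sum is proportional to the third one. -/
theorem exists_blockForm_eq (ht : t ∈ collinearTriples ℓ) (hu : u ∈ t) (hv : v ∈ t) (huv : u ≠ v) :
    ∃ x y, LinearIndependent k ![x, y] ∧
      Submodule.span k {x, y} = Submodule.span k {ℓ u, ℓ v} ∧
      ∃ c ≠ 0, blockForm ℓ t = C c * (linForm x * linForm y * linForm (x + y)) := by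
  classical
  obtain ⟨w, hwu, hwv, rfl⟩ := exists_eq_insert_pair_of_card_eq_three ht.1 hu hv huv
  obtain ⟨a, b, hab⟩ := Submodule.mem_span_pair.mp
    ((mem_span_pair_iff (hℓ.linearIndependent huv) hwu hwv).mpr ht)
  have ha : a ≠ 0 := by
    rintro rfl
    exact (LinearIndependent.pair_iff' ((hℓ.linearIndependent hwv).ne_zero 1)).mp
      (hℓ.linearIndependent hwv.symm) b (by simpa using hab)
  have hb : b ≠ 0 := by
    rintro rfl
    exact (LinearIndependent.pair_iff' ((hℓ.linearIndependent hwu).ne_zero 1)).mp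
      (hℓ.linearIndependent hwu.symm) a (by simpa using hab)
  refine ⟨a • ℓ u, b • ℓ v, (LinearIndependent.pair_smul_smul_iff ha.isUnit hb.isUnit).mpr
    (hℓ.linearIndependent huv), ?_, a⁻¹ * b⁻¹, mul_ne_zero (inv_ne_zero ha) (inv_ne_zero hb), ?_⟩
  · rw [Submodule.span_insert, Submodule.span_singleton_smul_eq ha.isUnit,
      Submodule.span_singleton_smul_eq hb.isUnit, ← Submodule.span_insert]
  · have hC : (C (a⁻¹ * b⁻¹) * (C a * C b) : MvPolynomial (Fin n) k) = 1 := by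
      rw [← C_mul, ← C_mul, mul_mul_mul_comm, inv_mul_cancel₀ ha, inv_mul_cancel₀ hb, mul_one, C_1]
    rw [hab, blockForm, Finset.prod_insert (by simp [hwu, hwv]), Finset.prod_pair huv, map_smul,
      map_smul, smul_eq_C_mul, smul_eq_C_mul]
    linear_combination -(linForm (ℓ u) * linForm (ℓ v) * linForm (ℓ w)) * hC

theorem blockForm_mem_linearIdeal_mul_jacobianIdeal (h3 : (3 : k) ≠ 0) (ht : t ∈ collinearTriples ℓ)
    (hu : u ∈ t) (hv : v ∈ t) (huv : u ≠ v) :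
    blockForm ℓ t ∈ linearIdeal (.span k {ℓ u, ℓ v}) * jacobianIdeal (blockForm ℓ t) := by
  obtain ⟨x, y, hxy, hspan, c, hc, heq⟩ := hℓ.exists_blockForm_eq ht hu hv huv
  rw [heq, jacobianIdeal_C_mul hc, jacobianIdeal_triangle hxy, ← hspan, linearIdeal_span_pair,
    map_add]
  exact Ideal.mul_mem_left _ _ (triangle_mem_mul (isUnit_three h3) _ _)

theorem radical_jacobianIdeal_blockForm (h3 : (3 : k) ≠ 0) (ht : t ∈ collinearTriples ℓ)
    (hu : u ∈ t) (hv : v ∈ t) (huv : u ≠ v) :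
    (jacobianIdeal (blockForm ℓ t)).radical = linearIdeal (.span k {ℓ u, ℓ v}) := by
  obtain ⟨x, y, hxy, hspan, c, hc, heq⟩ := hℓ.exists_blockForm_eq ht hu hv huv
  have hprime := linearIdeal_isPrime (.span k {x, y})
  rw [linearIdeal_span_pair] at hprime
  rw [heq, jacobianIdeal_C_mul hc, jacobianIdeal_triangle hxy, ← hspan, linearIdeal_span_pair,
    radical_span_triangle (isUnit_three h3) hprime]

theorem isFilteredBy_jacobianIdeal_blockForm (h3 : (3 : k) ≠ 0) (ht : t ∈ collinearTriples ℓ) :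
    IsFilteredBy (flatIdeals ℓ) (jacobianIdeal (blockForm ℓ t)) := by
  obtain ⟨u, hu, v, hv, huv⟩ := exists_ne_mem_of_mem_collinearTriples ht
  obtain ⟨x, y, hxy, hspan, c, hc, heq⟩ := hℓ.exists_blockForm_eq ht hu hv huv
  rw [heq, jacobianIdeal_C_mul hc, jacobianIdeal_triangle hxy]
  refine .span_triangle (isUnit_three h3) (isRelPrime_linForm hxy) (.of_mem ⟨u, v, huv, ?_⟩)
  rw [← linearIdeal_span_pair, hspan]

variable [Fintype ι]

theorem pairwiseDisjoint_blocks : (blocks ℓ : Set (Finset ι)).PairwiseDisjoint id := by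
  intro s hs t ht hst
  rcases mem_blocks.mp hs with hs | ⟨hs, hs'⟩ <;> rcases mem_blocks.mp ht with ht | ⟨ht, ht'⟩
  · exact hℓ.pairwiseDisjoint hs ht hst
  · exact (ht' s hs).symm
  · exact hs' t ht
  · obtain ⟨i, rfl⟩ := Finset.card_eq_one.mp hs
    obtain ⟨j, rfl⟩ := Finset.card_eq_one.mp ht
    exact Finset.disjoint_singleton.mpr (mt (congrArg singleton) hst)

theorem prod_blockForm : ∏ t ∈ blocks ℓ, blockForm ℓ t = ∏ i, linForm (ℓ i) := by
  classical
  have hcover : (blocks ℓ).biUnion id = Finset.univ := by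
    ext u
    simpa using exists_mem_blocks ℓ u
  rw [← hcover, Finset.prod_biUnion hℓ.pairwiseDisjoint_blocks]
  rfl

theorem isFilteredBy_liaisonSum [DecidableEq (Finset ι)]
    {I : Finset ι → Ideal (MvPolynomial (Fin n) k)} (hf : ∀ t ∈ blocks ℓ, blockForm ℓ t ∈ I t)
    (hI : ∀ t ∈ blocks ℓ, IsFilteredBy (flatIdeals ℓ) (I t)) :
    IsFilteredBy (flatIdeals ℓ) (liaisonSum (blockForm ℓ) I (blocks ℓ)) := by
  have hne {s t : Finset ι} (hs : s ∈ blocks ℓ) (ht : t ∈ blocks ℓ) (hst : s ≠ t) {i j : ι}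
      (hi : i ∈ s) (hj : j ∈ t) : i ≠ j :=
    Finset.disjoint_iff_ne.mp (hℓ.pairwiseDisjoint_blocks hs ht hst) i hi j hj
  refine GraphicCM.isFilteredBy_liaisonSum hf hI (fun s hs t ht hst => ?_)
    fun s hs t ht hst => .span_prod_prod (fun i hi j hj => ?_) fun i hi j hj => ?_
  · exact IsRelPrime.prod_left fun i hi => IsRelPrime.prod_right fun j hj =>
      isRelPrime_linForm (hℓ.linearIndependent (hne hs ht hst hi hj))
  · exact isRelPrime_linForm (hℓ.linearIndependent (hne hs ht hst hi hj))
  · exact .of_mem ⟨i, j, hne hs ht hst hi hj, linearIdeal_span_pair.symm⟩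

end HasDisjointTriples

end Arrangement

section Flats

open MvPolynomial Module

variable {k ι : Type*} [Field k] {n : ℕ} {ℓ : ι → Fin n → k} {u v w : ι} {s t : Finset ι}

theorem isHomogeneous_linForm {σ : Type*} [Fintype σ] (v : σ → k) : (linForm v).IsHomogeneous 1 :=
  IsHomogeneous.sum _ _ _ fun i _ => smul_eq_C_mul (X i) (v i) ▸ isHomogeneous_C_mul_X _ i

theorem finrank_span_pair {V : Type*} [AddCommGroup V] [Module k V] {x y : V}
    (h : LinearIndependent k ![x, y]) : finrank k (Submodule.span k {x, y}) = 2 := by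
  rw [← Matrix.range_cons_cons_empty, finrank_span_eq_card h, Fintype.card_fin]

theorem forall_mem_flatIdeals {p : Ideal (MvPolynomial (Fin n) k) → Prop}
    (hmem : ∀ t ∈ collinearTriples ℓ, ∀ u ∈ t, ∀ v ∈ t, u ≠ v →
      p (linearIdeal (.span k {ℓ u, ℓ v})))
    (hnot : ∀ u v, u ≠ v → (∀ t ∈ collinearTriples ℓ, u ∈ t → v ∉ t) →
      p (linearIdeal (.span k {ℓ u, ℓ v}))) : ∀ P ∈ flatIdeals ℓ, p P := by
  rintro _ ⟨u, v, huv, rfl⟩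
  by_cases h : ∀ t ∈ collinearTriples ℓ, u ∈ t → v ∉ t
  · exact hnot u v huv h
  · push Not at h
    obtain ⟨t, ht, hu, hv⟩ := h
    exact hmem t ht u hu v hv huv

/-- Each of the two hyperplanes is in its own block, and both block forms vanish on the flat. -/
theorem liaisonSum_le_linearIdeal [Fintype ι] [DecidableEq (Finset ι)]
    {I : Finset ι → Ideal (MvPolynomial (Fin n) k)} (huv : u ≠ v)
    (h : ∀ t ∈ collinearTriples ℓ, u ∈ t → v ∉ t) :
    liaisonSum (blockForm ℓ) I (blocks ℓ) ≤ linearIdeal (.span k {ℓ u, ℓ v}) := by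
  obtain ⟨s, hs, hus⟩ := exists_mem_blocks ℓ u
  obtain ⟨t, ht, hvt⟩ := exists_mem_blocks ℓ v
  refine liaisonSum_le_of_mem_of_mem hs ht ?_
    (prod_mem_of_mem hus (linForm_mem_linearIdeal (Submodule.subset_span (by simp))))
    (prod_mem_of_mem hvt (linForm_mem_linearIdeal (Submodule.subset_span (by simp))))
  rintro rfl
  rcases mem_blocks.mp hs with hs | ⟨hcard, -⟩
  · exact h s hs hus hvt
  · exact huv (Finset.card_le_one.mp hcard.le u hus v hvt)

theorem jacobianIdeal_le_linearIdeal [Fintype ι] (ℓ : ι → Fin n → k) (huv : u ≠ v) :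
    jacobianIdeal (∏ i, linForm (ℓ i)) ≤ linearIdeal (.span k {ℓ u, ℓ v}) := by
  classical
  exact (jacobianIdeal_prod_le _ _).trans <|
    liaisonSum_le_of_mem_of_mem (Finset.mem_univ u) (Finset.mem_univ v) huv
      (linForm_mem_linearIdeal (Submodule.subset_span (by simp)))
      (linForm_mem_linearIdeal (Submodule.subset_span (by simp)))

namespace HasDisjointTriples

variable (hℓ : HasDisjointTriples ℓ)
include hℓ

theorem height_linearIdeal (huv : u ≠ v) : (linearIdeal (.span k {ℓ u, ℓ v})).height = 2 := by
  rw [GraphicCM.height_linearIdeal, finrank_span_pair (hℓ.linearIndependent huv), Nat.cast_ofNat]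

theorem isCohenMacaulay_quotient [Finite ι] [Infinite k] {I : Ideal (MvPolynomial (Fin n) k)}
    (hI : IsFilteredBy (flatIdeals ℓ) I) : IsCohenMacaulay (MvPolynomial (Fin n) k ⧸ I) := by
  obtain ⟨W, hW⟩ := exists_forall_isCompl (c := n - 2)
    (fun p : {p : ι × ι // p.1 ≠ p.2} => Submodule.span k {ℓ p.1.1, ℓ p.1.2}) fun p => by
      have hle := Submodule.finrank_le (Submodule.span k {ℓ p.1.1, ℓ p.1.2})
      rw [finrank_span_pair (hℓ.linearIndependent p.2), finrank_fin_fun] at hle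
      rw [finrank_span_pair (hℓ.linearIndependent p.2), finrank_fin_fun]
      lia
  let := (subspaceAlgHom W).toAlgebra
  obtain ⟨_, _⟩ := hI.finite_projective (A := MvPolynomial (Fin (finrank k W)) k) <| by
    rintro _ ⟨u, v, huv, rfl⟩
    exact finite_projective_quotient_linearIdeal (hW ⟨(u, v), huv⟩)
  exact (isCohenMacaulay_of_isRegularRing (MvPolynomial (Fin (finrank k W)) k)).of_finite_flat

theorem linForm_notMem_of_notMem (ht : t ∈ collinearTriples ℓ) (hu : u ∈ t) (hv : v ∈ t)
    (huv : u ≠ v) (hw : w ∉ t) : linForm (ℓ w) ∉ linearIdeal (.span k {ℓ u, ℓ v}) := by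
  classical
  rw [linForm_mem_linearIdeal_iff, mem_span_pair_iff (hℓ.linearIndependent huv)
    (ne_of_mem_of_not_mem hu hw).symm
    (ne_of_mem_of_not_mem hv hw).symm]
  exact fun h => hw (hℓ.eq_of_mem_collinearTriples h ht (by simp) hu ▸ by simp)

theorem jacobianIdeal_blockForm_of_card_eq_one (ht : t.card = 1) :
    jacobianIdeal (blockForm ℓ t) = ⊤ := by
  obtain ⟨i, rfl⟩ := Finset.card_eq_one.mp ht
  rw [blockForm, Finset.prod_singleton, jacobianIdeal_linForm (hℓ.ne_zero i)]

variable [Fintype ι]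

/-- A prime containing the Jacobian ideal contains one form by Euler's formula, and differentiating
transversally to it yields a second one. -/
theorem exists_flatIdeal_le {Q : Ideal (MvPolynomial (Fin n) k)} [Q.IsPrime]
    (hcard : (Fintype.card ι : k) ≠ 0) (hQ : jacobianIdeal (∏ i, linForm (ℓ i)) ≤ Q) :
    ∃ u v, u ≠ v ∧ linearIdeal (.span k {ℓ u, ℓ v}) ≤ Q := by
  classical
  have hhom : (∏ i, linForm (ℓ i)).IsHomogeneous (Fintype.card ι) := by
    simpa using IsHomogeneous.prod Finset.univ (fun i => linForm (ℓ i)) (fun _ => 1) fun i _ =>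
      isHomogeneous_linForm (ℓ i)
  obtain ⟨u, -, hu⟩ := Ideal.IsPrime.prod_mem_iff.mp
    (hQ (mem_jacobianIdeal_of_isHomogeneous hhom hcard))
  obtain ⟨D, hD, -⟩ := exists_derivation_linForm (mt (Submodule.mem_bot k).mp (hℓ.ne_zero u))
  have hmem : ∏ i ∈ Finset.univ.erase u, linForm (ℓ i) ∈ Q := by
    have h := hQ (derivation_apply_mem_jacobianIdeal D)
    rw [← Finset.mul_prod_erase _ _ (Finset.mem_univ u), D.leibniz, hD, smul_eq_mul, smul_eq_mul,
      mul_one] at h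
    exact (Q.add_mem_iff_right (Q.mul_mem_right _ hu)).mp h
  obtain ⟨v, hv, hvQ⟩ := Ideal.IsPrime.prod_mem_iff.mp hmem
  refine ⟨u, v, (Finset.ne_of_mem_erase hv).symm, ?_⟩
  rw [linearIdeal_span_pair, Ideal.span_le, Set.pair_subset_iff]
  exact ⟨hu, hvQ⟩

theorem minimalPrimes_jacobianIdeal (hcard : (Fintype.card ι : k) ≠ 0) :
    (jacobianIdeal (∏ i, linForm (ℓ i))).minimalPrimes = flatIdeals ℓ := by
  apply Set.Subset.antisymm
  · intro Q hQ
    have := hQ.1.1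
    obtain ⟨u, v, huv, hle⟩ := hℓ.exists_flatIdeal_le hcard hQ.1.2
    exact ⟨u, v, huv, le_antisymm
      (hQ.2 ⟨linearIdeal_isPrime _, jacobianIdeal_le_linearIdeal ℓ huv⟩ hle) hle⟩
  · rintro _ ⟨u, v, huv, rfl⟩
    refine ⟨⟨linearIdeal_isPrime _, jacobianIdeal_le_linearIdeal ℓ huv⟩, fun Q ⟨_, hQ⟩ hle => ?_⟩
    obtain ⟨u', v', huv', hle'⟩ := hℓ.exists_flatIdeal_le hcard hQ
    have := linearIdeal_isPrime (.span k {ℓ u', ℓ v'})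
    refine (Ideal.eq_of_le_of_height_le _ (hle'.trans hle) ?_).ge.trans hle'
    rw [hℓ.height_linearIdeal huv, hℓ.height_linearIdeal huv']

theorem prod_erase_blockForm_notMem [DecidableEq (Finset ι)] (ht : t ∈ collinearTriples ℓ)
    (hu : u ∈ t) (hv : v ∈ t) (huv : u ≠ v) :
    ∏ s ∈ (blocks ℓ).erase t, blockForm ℓ s ∉ linearIdeal (.span k {ℓ u, ℓ v}) := fun h => by
  have := linearIdeal_isPrime (.span k {ℓ u, ℓ v})
  obtain ⟨s, hs, h⟩ := Ideal.IsPrime.prod_mem_iff.mp h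
  obtain ⟨w, hw, h⟩ := Ideal.IsPrime.prod_mem_iff.mp h
  have hst : Disjoint s t := hℓ.pairwiseDisjoint_blocks (Finset.mem_of_mem_erase hs)
    (mem_blocks.mpr (.inl ht)) (Finset.ne_of_mem_erase hs)
  exact hℓ.linForm_notMem_of_notMem ht hu hv huv (Finset.disjoint_left.mp hst hw) h

theorem exists_notMem_forall_mul_mem_of_mem (h3 : (3 : k) ≠ 0) (ht : t ∈ collinearTriples ℓ)
    (hu : u ∈ t) (hv : v ∈ t) (huv : u ≠ v) :
    ∃ s ∉ linearIdeal (.span k {ℓ u, ℓ v}), ∀ x ∈ jacobianIdeal (blockForm ℓ t),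
      s * x ∈ jacobianIdeal (∏ i, linForm (ℓ i)) := by
  classical
  have := linearIdeal_isPrime (.span k {ℓ u, ℓ v})
  rw [← hℓ.prod_blockForm, ← Finset.mul_prod_erase _ _ (mem_blocks.mpr (.inl ht))]
  exact exists_notMem_forall_mul_mem_jacobianIdeal_mul
    (hℓ.blockForm_mem_linearIdeal_mul_jacobianIdeal h3 ht hu hv huv)
    (hℓ.prod_erase_blockForm_notMem ht hu hv huv)

theorem exists_notMem_forall_mul_mem_of_forall_notMem (huv : u ≠ v)
    (h : ∀ t ∈ collinearTriples ℓ, u ∈ t → v ∉ t) :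
    ∃ s ∉ linearIdeal (.span k {ℓ u, ℓ v}), ∀ x ∈ linearIdeal (.span k {ℓ u, ℓ v}),
      s * x ∈ jacobianIdeal (∏ i, linForm (ℓ i)) := by
  classical
  have := linearIdeal_isPrime (.span k {ℓ u, ℓ v})
  have hJ := jacobianIdeal_linForm_mul (hℓ.linearIndependent huv)
  rw [← linearIdeal_span_pair] at hJ
  have hmul : linForm (ℓ u) * linForm (ℓ v) ∈ linearIdeal (.span k {ℓ u, ℓ v}) *
      jacobianIdeal (linForm (ℓ u) * linForm (ℓ v)) :=
    Ideal.mul_mem_mul (linForm_mem_linearIdeal (Submodule.mem_span_of_mem (Set.mem_insert _ _)))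
      (hJ ▸ linForm_mem_linearIdeal (Submodule.mem_span_of_mem (Set.mem_insert_of_mem _ rfl)))
  have hrest : ∏ w ∈ (Finset.univ.erase u).erase v, linForm (ℓ w) ∉
      linearIdeal (.span k {ℓ u, ℓ v}) := fun hmem => by
    obtain ⟨w, hw, hmem⟩ := Ideal.IsPrime.prod_mem_iff.mp hmem
    simp only [Finset.mem_erase] at hw
    rw [linForm_mem_linearIdeal_iff,
      mem_span_pair_iff (hℓ.linearIndependent huv) hw.2.1 hw.1] at hmem
    exact h _ hmem (by simp) (by simp)
  have hprod := exists_notMem_forall_mul_mem_jacobianIdeal_mul hmul hrest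
  rwa [mul_assoc, Finset.mul_prod_erase _ (fun i => linForm (ℓ i)) (by simpa using huv.symm),
    Finset.mul_prod_erase _ (fun i => linForm (ℓ i)) (Finset.mem_univ u), hJ] at hprod

theorem blockForm_mem_jacobianIdeal (h3 : (3 : k) ≠ 0) (ht : t ∈ blocks ℓ) :
    blockForm ℓ t ∈ jacobianIdeal (blockForm ℓ t) := by
  rcases mem_blocks.mp ht with ht | ⟨hcard, -⟩
  · obtain ⟨u, hu, v, hv, huv⟩ := exists_ne_mem_of_mem_collinearTriples ht
    exact Ideal.mul_le_right (I := linearIdeal (.span k {ℓ u, ℓ v}))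
      (hℓ.blockForm_mem_linearIdeal_mul_jacobianIdeal h3 ht hu hv huv)
  · exact hℓ.jacobianIdeal_blockForm_of_card_eq_one hcard ▸ Submodule.mem_top

theorem isFilteredBy_liaisonSum_jacobianIdeal [DecidableEq (Finset ι)] (h3 : (3 : k) ≠ 0) :
    IsFilteredBy (flatIdeals ℓ)
      (liaisonSum (blockForm ℓ) (fun t => jacobianIdeal (blockForm ℓ t)) (blocks ℓ)) := by
  refine hℓ.isFilteredBy_liaisonSum (fun t ht => hℓ.blockForm_mem_jacobianIdeal h3 ht)
    fun t ht => ?_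
  rcases mem_blocks.mp ht with ht | ⟨hcard, -⟩
  · exact hℓ.isFilteredBy_jacobianIdeal_blockForm h3 ht
  · rw [hℓ.jacobianIdeal_blockForm_of_card_eq_one hcard]
    exact .top

theorem isFilteredBy_liaisonSum_radical [DecidableEq (Finset ι)] (h3 : (3 : k) ≠ 0) :
    IsFilteredBy (flatIdeals ℓ)
      (liaisonSum (blockForm ℓ) (fun t => (jacobianIdeal (blockForm ℓ t)).radical) (blocks ℓ)) := by
  refine hℓ.isFilteredBy_liaisonSum
    (fun t ht => Ideal.le_radical (hℓ.blockForm_mem_jacobianIdeal h3 ht)) fun t ht => ?_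
  rcases mem_blocks.mp ht with ht | ⟨hcard, -⟩
  · obtain ⟨u, hu, v, hv, huv⟩ := exists_ne_mem_of_mem_collinearTriples ht
    rw [hℓ.radical_jacobianIdeal_blockForm h3 ht hu hv huv]
    exact .of_mem ⟨u, v, huv, rfl⟩
  · rw [hℓ.jacobianIdeal_blockForm_of_card_eq_one hcard, Ideal.radical_top]
    exact .top

theorem jacobianIdeal_le_liaisonSum [DecidableEq (Finset ι)] :
    jacobianIdeal (∏ i, linForm (ℓ i)) ≤
      liaisonSum (blockForm ℓ) (fun t => jacobianIdeal (blockForm ℓ t)) (blocks ℓ) :=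
  hℓ.prod_blockForm ▸ jacobianIdeal_prod_le _ _

theorem heightTwoPart_jacobianIdeal_eq [DecidableEq (Finset ι)] (h3 : (3 : k) ≠ 0)
    (hcard : (Fintype.card ι : k) ≠ 0) {K : Ideal (MvPolynomial (Fin n) k)}
    (hK : IsHeightTwoPart (jacobianIdeal (∏ i, linForm (ℓ i))) K) :
    K = liaisonSum (blockForm ℓ) (fun t => jacobianIdeal (blockForm ℓ t)) (blocks ℓ) := by
  have hmin := hℓ.minimalPrimes_jacobianIdeal hcard
  refine hK.eq_of_isFilteredBy_minimalPrimes ?_ (hmin ▸ hℓ.isFilteredBy_liaisonSum_jacobianIdeal h3)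
    hℓ.jacobianIdeal_le_liaisonSum ?_
  · rw [hmin]
    rintro _ ⟨u, v, huv, rfl⟩
    exact hℓ.height_linearIdeal huv
  · rw [hmin]
    refine forall_mem_flatIdeals (fun t ht u hu v hv huv => ?_) fun u v huv h => ?_
    · obtain ⟨s, hs, hmul⟩ := hℓ.exists_notMem_forall_mul_mem_of_mem h3 ht hu hv huv
      have ht' : t ∈ blocks ℓ := mem_blocks.mpr (.inl ht)
      exact ⟨s, hs, fun x hx => hmul x
        (liaisonSum_le_of_mem ht' (hℓ.blockForm_mem_jacobianIdeal h3 ht') hx)⟩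
    · obtain ⟨s, hs, hmul⟩ := hℓ.exists_notMem_forall_mul_mem_of_forall_notMem huv h
      exact ⟨s, hs, fun x hx => hmul x (liaisonSum_le_linearIdeal huv h hx)⟩

theorem radical_jacobianIdeal_eq [DecidableEq (Finset ι)] (h3 : (3 : k) ≠ 0)
    (hcard : (Fintype.card ι : k) ≠ 0) :
    (jacobianIdeal (∏ i, linForm (ℓ i))).radical =
      liaisonSum (blockForm ℓ) (fun t => (jacobianIdeal (blockForm ℓ t)).radical) (blocks ℓ) := by
  have hmin := hℓ.minimalPrimes_jacobianIdeal hcard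
  refine radical_eq_of_isFilteredBy_minimalPrimes (hmin ▸ hℓ.isFilteredBy_liaisonSum_radical h3)
    ?_ ?_ <;> rw [hmin]
  · refine forall_mem_flatIdeals (fun t ht u hu v hv huv => ?_) fun u v huv h =>
      liaisonSum_le_linearIdeal huv h
    have ht' : t ∈ blocks ℓ := mem_blocks.mpr (.inl ht)
    rw [← hℓ.radical_jacobianIdeal_blockForm h3 ht hu hv huv]
    exact liaisonSum_le_of_mem (I := fun t => (jacobianIdeal (blockForm ℓ t)).radical) ht'
      (Ideal.le_radical (hℓ.blockForm_mem_jacobianIdeal h3 ht'))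
  · refine forall_mem_flatIdeals (fun t ht u hu v hv huv => ?_) fun u v huv h => ?_
    · refine ⟨_, hℓ.prod_erase_blockForm_notMem ht hu hv huv, fun x hx => ?_⟩
      rw [← hℓ.radical_jacobianIdeal_blockForm h3 ht hu hv huv] at hx
      exact mul_mem_liaisonSum (mem_blocks.mpr (.inl ht)) hx
    · obtain ⟨s, hs, hmul⟩ := hℓ.exists_notMem_forall_mul_mem_of_forall_notMem huv h
      exact ⟨s, hs, fun x hx => liaisonSum_mono (fun _ => Ideal.le_radical)
        (hℓ.jacobianIdeal_le_liaisonSum (hmul x hx))⟩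

theorem isCohenMacaulay_quotient_jacobianIdeal [Infinite k] (h3 : (3 : k) ≠ 0)
    (hcard : (Fintype.card ι : k) = 0 → IsEmpty ι) :
    IsCohenMacaulay (MvPolynomial (Fin n) k ⧸ (jacobianIdeal (∏ i, linForm (ℓ i))).radical) ∧
      ∀ K, IsHeightTwoPart (jacobianIdeal (∏ i, linForm (ℓ i))) K →
        IsCohenMacaulay (MvPolynomial (Fin n) k ⧸ K) := by
  classical
  by_cases h : (Fintype.card ι : k) = 0
  · have := hcard h
    have hbot : jacobianIdeal (∏ i, linForm (ℓ i)) = ⊥ := by simp [jacobianIdeal]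
    rw [hbot, Ideal.isPrime_bot.radical]
    refine ⟨?_, fun K hK => ?_⟩
    · have : Module.Flat (MvPolynomial (Fin n) k) (MvPolynomial (Fin n) k ⧸
          (⊥ : Ideal (MvPolynomial (Fin n) k))) :=
        .of_linearEquiv (Submodule.quotEquivOfEqBot ⊥ rfl)
      exact (isCohenMacaulay_of_isRegularRing (MvPolynomial (Fin n) k)).of_finite_flat
    · rw [hK.eq_top_of_height_ne_two (by simp)]
      exact hℓ.isCohenMacaulay_quotient .top
  · refine ⟨?_, fun K hK => ?_⟩
    · rw [hℓ.radical_jacobianIdeal_eq h3 h]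
      exact hℓ.isCohenMacaulay_quotient (hℓ.isFilteredBy_liaisonSum_radical h3)
    · rw [hℓ.heightTwoPart_jacobianIdeal_eq h3 h hK]
      exact hℓ.isCohenMacaulay_quotient (hℓ.isFilteredBy_liaisonSum_jacobianIdeal h3)

end HasDisjointTriples

end Flats

section Graph

open MvPolynomial

variable {n : ℕ} {G : SimpleGraph (Fin n)}

/-- The edges of a graph, each as the pair of its ends in increasing order. -/
abbrev OrderedEdge (G : SimpleGraph (Fin n)) : Type :=
  {e : Fin n × Fin n // e.1 < e.2 ∧ G.Adj e.1 e.2}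

/-- The set of the two ends of an edge. -/
def ends (e : OrderedEdge G) : Finset (Fin n) :=
  {e.1.1, e.1.2}

/-- The normal vector of the hyperplane of the graphic arrangement given by an edge. -/
def edgeVector (k : Type*) [Field k] (e : OrderedEdge G) : Fin n → k :=
  Pi.single e.1.1 1 - Pi.single e.1.2 1

theorem card_ends (e : OrderedEdge G) : (ends e).card = 2 :=
  Finset.card_pair e.2.1.ne

theorem ends_injective : Function.Injective (ends (G := G)) := by
  rintro ⟨⟨a, b⟩, hab, _⟩ ⟨⟨c, d⟩, hcd, _⟩ h
  have h : ({a, b} : Finset (Fin n)) = {c, d} := h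
  rw [← Finset.coe_inj, Finset.coe_pair, Finset.coe_pair, Set.pair_eq_pair_iff] at h
  dsimp only at hab hcd
  ext <;> dsimp only <;> omega

theorem exists_mem_ends_notMem_ends {e e' : OrderedEdge G} (h : e ≠ e') :
    ∃ i ∈ ends e, i ∉ ends e' := by
  by_contra! hsub
  exact h (ends_injective (Finset.eq_of_subset_of_card_le hsub
    ((card_ends e').trans (card_ends e).symm).le))

theorem adj_of_ends_eq {e : OrderedEdge G} {a b : Fin n} (hab : a ≠ b) (h : ends e = {a, b}) :
    G.Adj a b := by
  have h : ({e.1.1, e.1.2} : Finset (Fin n)) = {a, b} := h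
  rw [← Finset.coe_inj, Finset.coe_pair, Finset.coe_pair, Set.pair_eq_pair_iff] at h
  rcases h with ⟨rfl, rfl⟩ | ⟨rfl, rfl⟩
  exacts [e.2.2, e.2.2.symm]

variable {k : Type*} [Field k]

theorem edgeVector_apply_eq_zero_iff {e : OrderedEdge G} {i : Fin n} :
    edgeVector k e i = 0 ↔ i ∉ ends e := by
  have hne := e.2.1.ne
  simp only [edgeVector, Pi.sub_apply, Pi.single_apply, ends, Finset.mem_insert,
    Finset.mem_singleton, not_or]
  split_ifs <;> simp_all

theorem linearIndependent_edgeVector {e e' : OrderedEdge G} (h : e ≠ e') :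
    LinearIndependent k ![edgeVector k e, edgeVector k e'] := by
  refine LinearIndependent.pair_iff.mpr fun a b hab => ?_
  obtain ⟨i, hi, hi'⟩ := exists_mem_ends_notMem_ends h
  obtain ⟨j, hj', hj⟩ := exists_mem_ends_notMem_ends h.symm
  have hab_apply (m : Fin n) : a * edgeVector k e m + b * edgeVector k e' m = 0 := congrFun hab m
  rw [← not_not (a := i ∈ ends e), ← edgeVector_apply_eq_zero_iff (k := k)] at hi
  rw [← not_not (a := j ∈ ends e'), ← edgeVector_apply_eq_zero_iff (k := k)] at hj'
  constructor
  · simpa [edgeVector_apply_eq_zero_iff.mpr hi', hi] using hab_apply i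
  · simpa [edgeVector_apply_eq_zero_iff.mpr hj, hj'] using hab_apply j

/-- Otherwise the edge vector of `e` has a nonzero coordinate at which the other two vanish. -/
theorem exists_ne_mem_ends {t : Finset (OrderedEdge G)}
    (ht : t ∈ collinearTriples (edgeVector k)) {e : OrderedEdge G} (he : e ∈ t) {i : Fin n}
    (hi : i ∈ ends e) : ∃ e' ∈ t, e' ≠ e ∧ i ∈ ends e' := by
  classical
  obtain ⟨e₁, he₁⟩ : (t.erase e).Nonempty :=
    Finset.card_pos.mp (by rw [Finset.card_erase_of_mem he, ht.1]; decide)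
  obtain ⟨hne, he₁⟩ := Finset.mem_erase.mp he₁
  obtain ⟨e₂, hne₁, hne₂, rfl⟩ := exists_eq_insert_pair_of_card_eq_three ht.1 he he₁ hne.symm
  by_contra! hnot
  rw [Finset.insert_comm, ← mem_span_pair_iff (linearIndependent_edgeVector hne₂) hne₁.symm
    hne.symm] at ht
  obtain ⟨a, b, hab⟩ := Submodule.mem_span_pair.mp ht
  refine (edgeVector_apply_eq_zero_iff (k := k)).mp ?_ hi
  rw [← hab]
  simp [edgeVector_apply_eq_zero_iff.mpr (hnot e₁ (by simp) hne),
    edgeVector_apply_eq_zero_iff.mpr (hnot e₂ (by simp) hne₁)]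

/-- Every vertex of a dependent triple of edges lies on at least two of them, so there are at most
three vertices, and these have three pairs. -/
theorem exists_image_ends_eq {t : Finset (OrderedEdge G)}
    (ht : t ∈ collinearTriples (edgeVector k)) :
    ∃ S : Finset (Fin n), S.card = 3 ∧ t.image ends = S.powersetCard 2 := by
  classical
  set S := t.biUnion ends
  have hle : S.card * 2 ≤ t.card * 2 := by
    refine Finset.card_mul_le_card_mul (fun i e => i ∈ ends e) (fun i hi => ?_) fun e _ => ?_
    · obtain ⟨e, he, hi⟩ := Finset.mem_biUnion.mp hi
      obtain ⟨e', he', hne, hi'⟩ := exists_ne_mem_ends ht he hi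
      exact Finset.one_lt_card.mpr ⟨e, by simp [Finset.bipartiteAbove, he, hi], e',
        by simp [Finset.bipartiteAbove, he', hi'], hne.symm⟩
    · exact (Finset.card_le_card fun i hi => (Finset.mem_filter.mp hi).2).trans (card_ends e).le
  have hsub : t.image ends ⊆ S.powersetCard 2 := Finset.image_subset_iff.mpr fun e he =>
    Finset.mem_powersetCard.mpr ⟨Finset.subset_biUnion_of_mem ends he, card_ends e⟩
  have hcard := Finset.card_le_card hsub
  rw [Finset.card_image_of_injective _ ends_injective, Finset.card_powersetCard, ht.1] at hcard
  have hS : S.card = 3 := by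
    refine le_antisymm (by rw [ht.1] at hle; omega) ?_
    by_contra! hlt
    exact absurd (hcard.trans (Nat.choose_le_choose 2 (Nat.le_of_lt_succ hlt))) (by decide)
  refine ⟨S, hS, Finset.eq_of_subset_of_card_le hsub ?_⟩
  rw [Finset.card_image_of_injective _ ends_injective, Finset.card_powersetCard, ht.1, hS]
  decide

theorem isNClique_of_image_ends_eq {t : Finset (OrderedEdge G)} {S : Finset (Fin n)}
    (hS : S.card = 3) (h : t.image ends = S.powersetCard 2) : G.IsNClique 3 S := by
  refine ⟨fun a ha b hb hab => ?_, hS⟩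
  have hmem : ({a, b} : Finset (Fin n)) ∈ S.powersetCard 2 :=
    Finset.mem_powersetCard.mpr ⟨Finset.insert_subset ha (Finset.singleton_subset_iff.mpr hb),
      Finset.card_pair hab⟩
  obtain ⟨e, -, he⟩ := Finset.mem_image.mp (h ▸ hmem)
  exact adj_of_ends_eq hab he

theorem hasDisjointTriples_edgeVector (hG : G.EdgeDisjointTriangles) :
    HasDisjointTriples (fun e : OrderedEdge G => edgeVector k e) where
  ne_zero e h :=
    edgeVector_apply_eq_zero_iff.mp (congrFun h e.1.1) (Finset.mem_insert_self _ _)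
  linearIndependent _ _ h := linearIndependent_edgeVector h
  pairwiseDisjoint t ht t' ht' hne := by
    rw [Function.onFun, id, id, Finset.disjoint_left]
    intro e he he'
    obtain ⟨S, hS, hSt⟩ := exists_image_ends_eq ht
    obtain ⟨S', hS', hSt'⟩ := exists_image_ends_eq ht'
    have hSS' : S ≠ S' := fun h =>
      hne (Finset.image_injective ends_injective (by rw [hSt, hSt', h]))
    have hsub := (Finset.mem_powersetCard.mp (hSt ▸ Finset.mem_image_of_mem ends he)).1
    have hsub' := (Finset.mem_powersetCard.mp (hSt' ▸ Finset.mem_image_of_mem ends he')).1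
    have hmem {i : Fin n} (hi : i ∈ ends e) : i ∈ (S ∩ S' : Set (Fin n)) :=
      ⟨hsub hi, hsub' hi⟩
    exact e.2.1.ne <| hG (isNClique_of_image_ends_eq hS hSt) (isNClique_of_image_ends_eq hS' hSt')
      hSS' (hmem (by simp [ends])) (hmem (by simp [ends]))

theorem graphicPolynomial_eq_prod [Fintype (OrderedEdge G)] :
    graphicPolynomial k G = ∏ e : OrderedEdge G, linForm (edgeVector k e) := by
  classical
  rw [graphicPolynomial, Finset.prod_subtype (F := ‹Fintype (OrderedEdge G)›) _ (by simp)]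
  simp only [edgeVector, map_sub, linForm_single]

theorem card_orderedEdge : Nat.card (OrderedEdge G) = G.edgeSet.ncard := by
  rw [← Nat.card_coe_set_eq]
  refine Nat.card_eq_of_bijective (fun e => ⟨s(e.1.1, e.1.2), e.2.2⟩) ⟨fun e e' h => ?_, ?_⟩
  · refine ends_injective (Finset.coe_injective ?_)
    simpa [ends, Set.pair_eq_pair_iff, Prod.ext_iff] using congrArg Subtype.val h
  · rintro ⟨⟨a, b⟩, hab⟩
    have hab : G.Adj a b := hab
    rcases hab.ne.lt_or_gt with hlt | hlt
    · exact ⟨⟨(a, b), hlt, hab⟩, rfl⟩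
    · exact ⟨⟨(b, a), hlt, hab.symm⟩, Subtype.ext Sym2.eq_swap⟩

end Graph

end GraphicCM

open GraphicCM in
theorem corollary5p1_general (k : Type*) [Field k] [Infinite k] (h3 : (3 : k) ≠ 0) (n : ℕ)
    (G : SimpleGraph (Fin n)) (hcard : (G.edgeSet.ncard : k) = 0 → G = ⊥)
    (hG : G.EdgeDisjointTriangles) :
    IsCohenMacaulay (MvPolynomial (Fin n) k ⧸ (jacobianIdeal (graphicPolynomial k G)).radical) ∧
      ∀ K, IsHeightTwoPart (jacobianIdeal (graphicPolynomial k G)) K →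
        IsCohenMacaulay (MvPolynomial (Fin n) k ⧸ K) := by
  classical
  rw [graphicPolynomial_eq_prod]
  refine (hasDisjointTriples_edgeVector hG).isCohenMacaulay_quotient_jacobianIdeal h3 fun h => ?_
  rw [Fintype.card_eq_nat_card, card_orderedEdge] at h
  exact ⟨fun e => by simpa [hcard h] using e.2.2⟩

theorem corollary5p1 (k : Type*) [Field k] [CharZero k] (n : ℕ) (G : SimpleGraph (Fin n))
    (hG : G.EdgeDisjointTriangles) :
    GraphicCM.IsCohenMacaulay (MvPolynomial (Fin n) k ⧸
        (GraphicCM.jacobianIdeal (GraphicCM.graphicPolynomial k G)).radical) ∧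
      ∀ K : Ideal (MvPolynomial (Fin n) k),
        GraphicCM.IsHeightTwoPart
            (GraphicCM.jacobianIdeal (GraphicCM.graphicPolynomial k G)) K →
          GraphicCM.IsCohenMacaulay (MvPolynomial (Fin n) k ⧸ K) :=
  corollary5p1_general k three_ne_zero n G (fun h => SimpleGraph.edgeSet_eq_empty.mp <|
    (Set.ncard_eq_zero (Set.toFinite _)).mp (Nat.cast_eq_zero.mp h)) hG
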